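/- A \emph{Frith frame} is a pair $(L,S)$ where $L$ is a frame and $S\subseteq L$ is a bounded sublattice such that every element of $L$ is a join of elements of $S$; a morphism $(L,S)\to(M,T)$ is a frame homomorphism $h:L\to M$ with $h[S]\subseteq T$. A \emph{biframe} is a triple $\mathcal L=(L,L_+,L_-)$ where $L_+,L_-$ are subframes of the frame $L$ and every element of $L$ is a join of finite meets of elements of $L_+\cup L_-$; a morphism is a frame homomorphism of the main components that maps positive elements to positive elements and negative elements to negative elements. An element of $L_+$ (resp. of $L_-$) is \emph{bicomplemented} if it has a complement in $L$ that lies in $L_-$ (resp. in $L_+$); $\mathfrak b_+(\mathcal L)$ is the lattice of bicomplemented elements of $L_+$. The biframe is \emph{compact} if the top element of $L$ is compact, and \emph{zero-dimensional} if every element of $L_+$ (resp. of $L_-$) is a join of bicomplemented elements of $L_+$ (resp. of $L_-$). For a frame $L$ let $\mathcal C L$ be the frame of all frame congruences on $L$ ordered by inclusion, and put $\nabla_a=\{(x,y)\mid a\vee x=a\vee y\}$, $\Delta_a=\{(x,y)\mid a\wedge x=a\wedge y\}$. For a Frith frame $(L,S)$ let $\mathcal C_SL$, $\nabla L$ and $\Delta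 S$ be the subframes of $\mathcal C L$ generated by $\{\nabla_a\mid a\in L\}\cup\{\Delta_s\mid s\in S\}$, by $\{\nabla_a\mid a\in L\}$ and by $\{\Delta_s\mid s\in S\}$, respectively. The functor $\mathbf{Sk}$ from Frith frames to biframes sends $(L,S)$ to $(\mathcal C_SL,\nabla L,\Delta S)$ and a morphism $h$ to the unique frame homomorphism $\overline h$ with $\overline h(\nabla_a)=\nabla_{h(a)}$ for all $a\in L$. The functor $\mathbf B_+$ from biframes to Frith frames sends $\mathcal L$ to $(\langle\mathfrak b_+(\mathcal L)\rangle,\mathfrak b_+(\mathcal L))$, where $\langle\mathfrak b_+(\mathcal L)\rangle$ is the subframe of $L_+$ generated by $\mathfrak b_+(\mathcal L)$, and acts on morphisms by restriction and corestriction. There is an adjunction $\mathbf{Sk}\dashv\mathbf B_+$ whose unit at $(L,S)$ is $a\mapsto\nabla_a$. A Frith frame $(L,B)$ is \emph{symmetric} if $B$ is a Boolean algebra. A symmetric Frith frame $(L,B)$ is \emph{complete} if every morphism $h:(M,C)\to(L,B)$ of Frith frames with $(M,C)$ symmetric, $h$ dense (that is, $h(a)=0$ implies $a=0$) and $h[C]=B$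 is an isomorphism. A Frith frame $(L,S)$ is \emph{complete} if the symmetric Frith frame $(\mathcal C_SL,\overline S)$ is complete, where $\overline S$ is the sublattice of $\mathcal C_SL$ generated by the elements $\nabla_s$ and their complements $\Delta_s$, $s\in S$. \textbf{Corollary.} The adjunction $\mathbf{Sk}\dashv\mathbf B_+$ restricts to an equivalence between the full subcategory of complete Frith frames and the full subcategory of compact zero-dimensional biframes. That is: $\mathbf{Sk}$ sends complete Frith frames to compact zero-dimensional biframes, $\mathbf B_+$ sends compact zero-dimensional biframes to complete Frith frames, and the restricted functors are mutually quasi-inverse equivalences of categories, via the unit and the counit of the adjunction, which are isomorphisms at all objects of these subcategories. -/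

import Mathlib

open CategoryTheory

universe u

namespace FrithBiframe

/-! ### Subframes -/

/-- A subframe of a frame: a subset closed under finite meets and arbitrary joins. -/
structure Subframe (L : Type u) [Order.Frame L] where
  carrier : Set L
  top_mem' : ⊤ ∈ carrier
  inf_mem' : ∀ {a b : L}, a ∈ carrier → b ∈ carrier → a ⊓ b ∈ carrier
  sSup_mem' : ∀ {A : Set L}, A ⊆ carrier → sSup A ∈ carrier

namespace Subframe

variable {L : Type u} [Order.Frame L]

instance : SetLike (Subframe L) L where
  coe K := K.carrier
  coe_injective := by
    rintro ⟨s, _, _, _⟩ ⟨t, _, _, _⟩ h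
    cases h
    rfl

lemma top_mem (K : Subframe L) : ⊤ ∈ K := K.top_mem'

lemma inf_mem (K : Subframe L) {a b : L} (ha : a ∈ K) (hb : b ∈ K) : a ⊓ b ∈ K :=
  K.inf_mem' ha hb

lemma sSup_mem (K : Subframe L) {A : Set L} (hA : A ⊆ K) : sSup A ∈ K := K.sSup_mem' hA

lemma bot_mem (K : Subframe L) : ⊥ ∈ K := by
  have h := K.sSup_mem (Set.empty_subset (K : Set L))
  rwa [sSup_empty] at h

lemma sup_mem (K : Subframe L) {a b : L} (ha : a ∈ K) (hb : b ∈ K) : a ⊔ b ∈ K := by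
  have h := K.sSup_mem (A := {a, b}) (Set.pair_subset ha hb)
  rwa [sSup_pair] at h

lemma image_val_subset (K : Subframe L) (A : Set K) : (Subtype.val '' A : Set L) ⊆ K := by
  rintro _ ⟨x, _, rfl⟩
  exact x.2

/-- Joins and finite meets in a subframe are those of the ambient frame. -/
instance instCompleteLattice (K : Subframe L) : CompleteLattice K where
  __ := Subtype.partialOrder (fun x => x ∈ K)
  sup a b := ⟨a.1 ⊔ b.1, K.sup_mem a.2 b.2⟩
  le_sup_left a b := show a.1 ≤ a.1 ⊔ b.1 from le_sup_left
  le_sup_right a b := show b.1 ≤ a.1 ⊔ b.1 from le_sup_right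
  sup_le a b c h₁ h₂ := show a.1 ⊔ b.1 ≤ c.1 from sup_le h₁ h₂
  inf a b := ⟨a.1 ⊓ b.1, K.inf_mem a.2 b.2⟩
  inf_le_left a b := show a.1 ⊓ b.1 ≤ a.1 from inf_le_left
  inf_le_right a b := show a.1 ⊓ b.1 ≤ b.1 from inf_le_right
  le_inf a b c h₁ h₂ := show a.1 ≤ b.1 ⊓ c.1 from le_inf h₁ h₂
  top := ⟨⊤, K.top_mem⟩
  le_top a := show a.1 ≤ ⊤ from le_top
  bot := ⟨⊥, K.bot_mem⟩
  bot_le a := show ⊥ ≤ a.1 from bot_le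
  sSup A := ⟨sSup (Subtype.val '' A), K.sSup_mem (K.image_val_subset A)⟩
  sInf A := ⟨sSup (Subtype.val '' lowerBounds A), K.sSup_mem (K.image_val_subset _)⟩
  isLUB_sSup A :=
    ⟨fun a ha => show a.1 ≤ sSup (Subtype.val '' A) from le_sSup ⟨a, ha, rfl⟩,
     fun b hb => show sSup (Subtype.val '' A) ≤ b.1 from sSup_le (by
      rintro _ ⟨a, ha, rfl⟩
      exact hb ha)⟩
  isGLB_sInf A :=
    ⟨fun a ha => show sSup (Subtype.val '' lowerBounds A) ≤ a.1 from sSup_le (by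
      rintro _ ⟨b, hb, rfl⟩
      exact hb ha),
     fun b hb => show b.1 ≤ sSup (Subtype.val '' lowerBounds A) from le_sSup ⟨b, hb, rfl⟩⟩

@[simp] lemma coe_top (K : Subframe L) : ((⊤ : K) : L) = ⊤ := rfl
@[simp] lemma coe_bot (K : Subframe L) : ((⊥ : K) : L) = ⊥ := rfl
@[simp] lemma coe_inf (K : Subframe L) (a b : K) : ((a ⊓ b : K) : L) = a.1 ⊓ b.1 := rfl
@[simp] lemma coe_sup (K : Subframe L) (a b : K) : ((a ⊔ b : K) : L) = a.1 ⊔ b.1 := rfl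
lemma coe_sSup (K : Subframe L) (A : Set K) : ((sSup A : K) : L) = sSup (Subtype.val '' A) := rfl

instance instFrame (K : Subframe L) : Order.Frame K :=
  Order.Frame.ofMinimalAxioms
    { inf_sSup_le_iSup_inf := fun a A => by
        show a.1 ⊓ sSup (Subtype.val '' A) ≤ ((⨆ b ∈ A, a ⊓ b : K) : L)
        rw [inf_sSup_eq]
        refine iSup₂_le ?_
        rintro _ ⟨b, hb, rfl⟩
        have h : a ⊓ b ≤ (⨆ b ∈ A, a ⊓ b : K) := le_iSup₂_of_le b hb le_rfl
        exact h }

/-- The subframe generated by a subset. -/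
def closure (X : Set L) : Subframe L where
  carrier := {x | ∀ K : Subframe L, X ⊆ K → x ∈ K}
  top_mem' K _ := K.top_mem
  inf_mem' ha hb K hK := K.inf_mem (ha K hK) (hb K hK)
  sSup_mem' hA K hK := K.sSup_mem fun _ hx => hA hx K hK

lemma subset_closure (X : Set L) : X ⊆ closure X := fun _ hx _ hK => hK hx

lemma closure_le {X : Set L} {K : Subframe L} (h : X ⊆ K) {x : L} (hx : x ∈ closure X) : x ∈ K :=
  hx K h

/-- The subframe of all joins of subsets of `B`, where `B` is closed under finite meets. -/
def joins (B : Set L) (htop : ⊤ ∈ B) (hinf : ∀ a ∈ B, ∀ b ∈ B, a ⊓ b ∈ B) : Subframe L where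
  carrier := {x | ∃ A ⊆ B, x = sSup A}
  top_mem' := ⟨{⊤}, by simpa using htop, by simp⟩
  inf_mem' := by
    rintro _ _ ⟨A, hA, rfl⟩ ⟨A', hA', rfl⟩
    refine ⟨{z | ∃ a ∈ A, ∃ b ∈ A', z = a ⊓ b}, ?_, ?_⟩
    · rintro _ ⟨a, ha, b, hb, rfl⟩
      exact hinf a (hA ha) b (hA' hb)
    · apply le_antisymm
      · rw [sSup_inf_sSup]
        exact iSup₂_le fun p hp => le_sSup ⟨p.1, hp.1, p.2, hp.2, rfl⟩
      · refine sSup_le ?_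
        rintro _ ⟨a, ha, b, hb, rfl⟩
        exact inf_le_inf (le_sSup ha) (le_sSup hb)
  sSup_mem' := by
    intro A hA
    refine ⟨{b | b ∈ B ∧ ∃ a ∈ A, b ≤ a}, fun b hb => hb.1, ?_⟩
    apply le_antisymm
    · refine sSup_le fun a ha => ?_
      obtain ⟨C, hC, rfl⟩ := hA ha
      exact sSup_le fun c hc => le_sSup ⟨hC hc, _, ha, le_sSup hc⟩
    · refine sSup_le ?_
      rintro b ⟨_, a, ha, hba⟩
      exact hba.trans (le_sSup ha)

/-- The preimage of a subframe under a frame homomorphism. -/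
def comap {M : Type u} [Order.Frame M] (f : FrameHom L M) (K : Subframe M) : Subframe L where
  carrier := {x | f x ∈ K}
  top_mem' := by
    show f ⊤ ∈ K
    rw [map_top]
    exact K.top_mem
  inf_mem' := by
    intro a b ha hb
    show f (a ⊓ b) ∈ K
    rw [map_inf]
    exact K.inf_mem ha hb
  sSup_mem' := by
    intro A hA
    show f (sSup A) ∈ K
    rw [map_sSup]
    refine K.sSup_mem ?_
    rintro _ ⟨a, ha, rfl⟩
    exact hA ha

/-- The subframe on which two frame homomorphisms agree. -/
def eqLocus {M : Type u} [Order.Frame M] (f g : FrameHom L M) : Subframe L where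
  carrier := {x | f x = g x}
  top_mem' := by
    show f ⊤ = g ⊤
    rw [map_top, map_top]
  inf_mem' := by
    intro a b ha hb
    show f (a ⊓ b) = g (a ⊓ b)
    rw [map_inf, map_inf, show f a = g a from ha, show f b = g b from hb]
  sSup_mem' := by
    intro A hA
    show f (sSup A) = g (sSup A)
    rw [map_sSup, map_sSup]
    exact congrArg sSup (Set.image_congr fun a ha => hA ha)

/-- If a subframe of `closure X` contains all generators, then it is everything. -/
lemma mem_of_generators {X : Set L} (J : Subframe (closure X))
    (hJ : ∀ x (hx : x ∈ X), (⟨x, subset_closure X hx⟩ : closure X) ∈ J) (x : closure X) :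
    x ∈ J := by
  let J' : Subframe L :=
    { carrier := {y | ∃ hy : y ∈ closure X, (⟨y, hy⟩ : closure X) ∈ J}
      top_mem' := ⟨_, J.top_mem⟩
      inf_mem' := by
        rintro a b ⟨ha, ha'⟩ ⟨hb, hb'⟩
        exact ⟨_, J.inf_mem ha' hb'⟩
      sSup_mem' := by
        intro A hA
        have h : Subtype.val '' {z : closure X | z.1 ∈ A} = A := by
          ext y
          constructor
          · rintro ⟨z, hz, rfl⟩
            exact hz
          · intro hy
            exact ⟨⟨y, (hA hy).1⟩, hy, rfl⟩
        have h2 : sSup {z : closure X | z.1 ∈ A} ∈ J := J.sSup_mem fun z hz => (hA hz).2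
        have h3 : ((sSup {z : closure X | z.1 ∈ A} : closure X) : L) = sSup A := by
          rw [coe_sSup, h]
        rw [← h3]
        exact ⟨(sSup {z : closure X | z.1 ∈ A}).2, h2⟩ }
  have h : x.1 ∈ J' := closure_le (K := J') (fun y hy => ⟨subset_closure X hy, hJ y hy⟩) x.2
  exact h.2

/-- The restriction and corestriction of a frame homomorphism to subframes. -/
def restrict {M : Type u} [Order.Frame M] (f : FrameHom L M) (K : Subframe L) (K' : Subframe M)
    (h : ∀ x ∈ K, f x ∈ K') : FrameHom K K' where
  toFun x := ⟨f x.1, h x.1 x.2⟩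
  map_inf' a b := Subtype.ext (map_inf f a.1 b.1)
  map_top' := Subtype.ext (map_top f)
  map_sSup' A := Subtype.ext (by
    show f (sSup (Subtype.val '' A)) = sSup (Subtype.val '' _)
    rw [map_sSup, Set.image_image, Set.image_image])

/-- The corestriction of a frame homomorphism to a subframe. -/
def corestrict {M : Type u} [Order.Frame M] (f : FrameHom L M) (K : Subframe M)
    (h : ∀ x, f x ∈ K) : FrameHom L K where
  toFun x := ⟨f x, h x⟩
  map_inf' a b := Subtype.ext (map_inf f a b)
  map_top' := Subtype.ext (map_top f)
  map_sSup' A := Subtype.ext (by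
    show f (sSup A) = sSup (Subtype.val '' _)
    rw [map_sSup, Set.image_image])

/-- The inclusion of a subframe. -/
def incl (K : Subframe L) : FrameHom K L where
  toFun := Subtype.val
  map_inf' _ _ := rfl
  map_top' := rfl
  map_sSup' _ := rfl

end Subframe

/-! ### The frame of congruences -/

/-- A frame congruence: an equivalence relation compatible with finite meets and arbitrary joins. -/
structure FrameCongruence (L : Type u) [Order.Frame L] where
  rel : L → L → Prop
  iseqv : Equivalence rel
  inf' : ∀ {a b c d : L}, rel a b → rel c d → rel (a ⊓ c) (b ⊓ d)
  sSup' : ∀ A : Set (L × L), (∀ p ∈ A, rel p.1 p.2) →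
    rel (sSup (Prod.fst '' A)) (sSup (Prod.snd '' A))

namespace FrameCongruence

variable {L : Type u} [Order.Frame L]

lemma ext' {θ φ : FrameCongruence L} (h : ∀ x y, θ.rel x y ↔ φ.rel x y) : θ = φ := by
  obtain ⟨r, _, _, _⟩ := θ
  obtain ⟨s, _, _, _⟩ := φ
  have : r = s := by
    funext x y
    exact propext (h x y)
  subst this
  rfl

/-- Congruences are ordered by inclusion. -/
instance : PartialOrder (FrameCongruence L) where
  le θ φ := ∀ x y, θ.rel x y → φ.rel x y
  le_refl _ _ _ h := h
  le_trans _ _ _ h₁ h₂ x y h := h₂ x y (h₁ x y h)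
  le_antisymm _ _ h₁ h₂ := ext' fun x y => ⟨h₁ x y, h₂ x y⟩

lemma le_def {θ φ : FrameCongruence L} : θ ≤ φ ↔ ∀ x y, θ.rel x y → φ.rel x y := Iff.rfl

/-- Meets of congruences are intersections. -/
instance : InfSet (FrameCongruence L) where
  sInf T :=
    { rel := fun x y => ∀ θ ∈ T, θ.rel x y
      iseqv := ⟨fun x θ _ => θ.iseqv.refl x, fun h θ hθ => θ.iseqv.symm (h θ hθ),
        fun h₁ h₂ θ hθ => θ.iseqv.trans (h₁ θ hθ) (h₂ θ hθ)⟩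
      inf' := fun h₁ h₂ θ hθ => θ.inf' (h₁ θ hθ) (h₂ θ hθ)
      sSup' := fun A hA θ hθ => θ.sSup' A fun p hp => hA p hp θ hθ }

instance : Min (FrameCongruence L) where
  min θ φ :=
    { rel := fun x y => θ.rel x y ∧ φ.rel x y
      iseqv := ⟨fun x => ⟨θ.iseqv.refl x, φ.iseqv.refl x⟩,
        fun h => ⟨θ.iseqv.symm h.1, φ.iseqv.symm h.2⟩,
        fun h₁ h₂ => ⟨θ.iseqv.trans h₁.1 h₂.1, φ.iseqv.trans h₁.2 h₂.2⟩⟩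
      inf' := fun h₁ h₂ => ⟨θ.inf' h₁.1 h₂.1, φ.inf' h₁.2 h₂.2⟩
      sSup' := fun A hA => ⟨θ.sSup' A fun p hp => (hA p hp).1,
        φ.sSup' A fun p hp => (hA p hp).2⟩ }

instance : CompleteLattice (FrameCongruence L) :=
  { completeLatticeOfInf (FrameCongruence L) (fun _ =>
      ⟨fun θ hθ _ _ h => h θ hθ, fun _ hφ x y h _ hθ => hφ hθ x y h⟩) with
    inf := fun θ φ => θ ⊓ φ
    inf_le_left := fun _ _ _ _ h => h.1
    inf_le_right := fun _ _ _ _ h => h.2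
    le_inf := fun _ _ _ h₁ h₂ x y h => ⟨h₁ x y h, h₂ x y h⟩ }

lemma inf_rel {θ φ : FrameCongruence L} {x y : L} :
    (θ ⊓ φ).rel x y ↔ θ.rel x y ∧ φ.rel x y := Iff.rfl

lemma sSup_rel (θ : FrameCongruence L) {A : Set L} (b : L) (hne : A.Nonempty)
    (h : ∀ a ∈ A, θ.rel a b) : θ.rel (sSup A) b := by
  have h2 := θ.sSup' ((fun a => (a, b)) '' A) (by
    rintro _ ⟨a, ha, rfl⟩
    exact h a ha)
  simpa [Set.image_image, hne.image_const] using h2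

lemma sup_rel (θ : FrameCongruence L) {a b c d : L} (h₁ : θ.rel a b) (h₂ : θ.rel c d) :
    θ.rel (a ⊔ c) (b ⊔ d) := by
  have h := θ.sSup' {(a, b), (c, d)} (by
    rintro p (rfl | rfl)
    · exact h₁
    · exact h₂)
  simpa [Set.image_pair, sSup_pair] using h

/-- The nucleus sending `a` to the largest element congruent to `a`. -/
def toNucleus (θ : FrameCongruence L) : Nucleus L :=
  have key : ∀ a, θ.rel (sSup {b | θ.rel b a}) a := fun a =>
    θ.sSup_rel a ⟨a, θ.iseqv.refl a⟩ fun _ h => h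
  { toFun := fun a => sSup {b | θ.rel b a}
    map_inf' := fun a b => by
      apply le_antisymm
      · have h : ∀ x y, sSup {c | θ.rel c (x ⊓ y)} ≤ sSup {c | θ.rel c x} := by
          intro x y
          have h1 : θ.rel (sSup {c | θ.rel c (x ⊓ y)} ⊔ x) x := by
            have := θ.sup_rel (key (x ⊓ y)) (θ.iseqv.refl x)
            rwa [show (x ⊓ y) ⊔ x = x from sup_eq_right.2 inf_le_left] at this
          exact le_sup_left.trans (le_sSup h1)
        refine le_inf (h a b) ?_
        have := h b a
        rwa [inf_comm b a] at this
      · exact le_sSup (θ.inf' (key a) (key b))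
    idempotent' := fun a => sSup_le fun b hb => le_sSup (θ.iseqv.trans hb (key a))
    le_apply' := fun a => le_sSup (θ.iseqv.refl a) }

lemma toNucleus_rel (θ : FrameCongruence L) (a : L) : θ.rel (θ.toNucleus a) a :=
  θ.sSup_rel a ⟨a, θ.iseqv.refl a⟩ fun _ h => h

lemma rel_iff (θ : FrameCongruence L) (a b : L) :
    θ.rel a b ↔ θ.toNucleus a = θ.toNucleus b := by
  constructor
  · intro h
    show sSup {c | θ.rel c a} = sSup {c | θ.rel c b}
    congr 1
    ext c
    exact ⟨fun hc => θ.iseqv.trans hc h, fun hc => θ.iseqv.trans hc (θ.iseqv.symm h)⟩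
  · intro h
    have h1 := θ.toNucleus_rel a
    rw [h] at h1
    exact θ.iseqv.trans (θ.iseqv.symm h1) (θ.toNucleus_rel b)

/-- The congruence of all pairs identified by a nucleus. -/
def ofNucleus (n : Nucleus L) : FrameCongruence L where
  rel a b := n a = n b
  iseqv := ⟨fun _ => rfl, Eq.symm, Eq.trans⟩
  inf' h₁ h₂ := by rw [n.map_inf, n.map_inf, h₁, h₂]
  sSup' A hA := by
    have h : ∀ (B : Set (L × L)) (f g : L × L → L), (∀ p ∈ B, n (f p) = n (g p)) →
        n (sSup (f '' B)) ≤ n (sSup (g '' B)) := by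
      intro B f g hB
      rw [← n.idempotent (sSup (g '' B))]
      refine n.monotone (sSup_le ?_)
      rintro _ ⟨p, hp, rfl⟩
      exact n.le_apply.trans ((hB p hp).le.trans (n.monotone (le_sSup ⟨p, hp, rfl⟩)))
    exact le_antisymm (h A _ _ hA) (h A _ _ fun p hp => (hA p hp).symm)

/-- Congruences correspond to nuclei. -/
def nucleusIso : FrameCongruence L ≃o Nucleus L where
  toFun := toNucleus
  invFun := ofNucleus
  left_inv θ := ext' fun x y => (θ.rel_iff x y).symm
  right_inv n := by
    ext a
    apply le_antisymm
    · exact sSup_le fun b hb => n.le_apply.trans (le_of_eq hb)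
    · exact le_sSup (n.idempotent a)
  map_rel_iff' := by
    intro θ φ
    constructor
    · intro h x y hxy
      have key : ∀ x y, θ.rel x y → y ≤ φ.toNucleus x := fun x y hxy =>
        le_trans (le_sSup (show y ∈ {b | θ.rel b x} from θ.iseqv.symm hxy)) (h x)
      rw [rel_iff]
      apply le_antisymm
      · rw [← φ.toNucleus.idempotent y]
        exact φ.toNucleus.monotone (key y x (θ.iseqv.symm hxy))
      · rw [← φ.toNucleus.idempotent x]
        exact φ.toNucleus.monotone (key x y hxy)
    · intro h a
      exact sSup_le fun b hb => le_sSup (h b a hb)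

/-- The congruences on a frame form a frame. -/
instance : Order.Frame (FrameCongruence L) :=
  Order.Frame.ofMinimalAxioms
    { inf_sSup_le_iSup_inf := fun a s => by
        rw [← nucleusIso.le_iff_le]
        simp only [OrderIso.map_inf, OrderIso.map_sSup, OrderIso.map_iSup, inf_iSup_eq]
        exact le_rfl }

/-- The closed congruence of `a`. -/
def nabla (a : L) : FrameCongruence L where
  rel x y := a ⊔ x = a ⊔ y
  iseqv := ⟨fun _ => rfl, Eq.symm, Eq.trans⟩
  inf' h₁ h₂ := by rw [sup_inf_left, sup_inf_left, h₁, h₂]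
  sSup' A hA := by
    have h : ∀ (B : Set (L × L)) (f g : L × L → L), (∀ p ∈ B, a ⊔ f p = a ⊔ g p) →
        a ⊔ sSup (f '' B) ≤ a ⊔ sSup (g '' B) := by
      intro B f g hB
      refine sup_le le_sup_left (sSup_le ?_)
      rintro _ ⟨p, hp, rfl⟩
      exact le_sup_right.trans ((hB p hp).le.trans
        (sup_le_sup_left (le_sSup (Set.mem_image_of_mem g hp)) a))
    exact le_antisymm (h A _ _ hA) (h A _ _ fun p hp => (hA p hp).symm)

/-- The open congruence of `a`. -/
def delta (a : L) : FrameCongruence L where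
  rel x y := a ⊓ x = a ⊓ y
  iseqv := ⟨fun _ => rfl, Eq.symm, Eq.trans⟩
  inf' {x y z w} h₁ h₂ := by
    rw [← inf_assoc, h₁, inf_right_comm, h₂, inf_assoc, inf_comm w y]
  sSup' A hA := by
    have h : ∀ (B : Set (L × L)) (f g : L × L → L), (∀ p ∈ B, a ⊓ f p = a ⊓ g p) →
        a ⊓ sSup (f '' B) ≤ a ⊓ sSup (g '' B) := by
      intro B f g hB
      rw [inf_sSup_eq]
      refine iSup₂_le ?_
      rintro _ ⟨p, hp, rfl⟩
      rw [hB p hp]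
      exact inf_le_inf_left a (le_sSup ⟨p, hp, rfl⟩)
    exact le_antisymm (h A _ _ hA) (h A _ _ fun p hp => (hA p hp).symm)

lemma nabla_le_iff {a : L} {θ : FrameCongruence L} : nabla a ≤ θ ↔ θ.rel ⊥ a := by
  constructor
  · intro h
    exact h _ _ (show a ⊔ ⊥ = a ⊔ a by simp)
  · intro h x y (hxy : a ⊔ x = a ⊔ y)
    have key : ∀ z, θ.rel z (a ⊔ z) := fun z => by
      have := θ.sup_rel h (θ.iseqv.refl z)
      rwa [bot_sup_eq] at this
    have h2 := key x
    rw [hxy] at h2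
    exact θ.iseqv.trans h2 (θ.iseqv.symm (key y))

lemma delta_le_iff {a : L} {θ : FrameCongruence L} : delta a ≤ θ ↔ θ.rel a ⊤ := by
  constructor
  · intro h
    exact h _ _ (show a ⊓ a = a ⊓ ⊤ by simp)
  · intro h x y (hxy : a ⊓ x = a ⊓ y)
    have key : ∀ z, θ.rel (a ⊓ z) z := fun z => by
      have := θ.inf' h (θ.iseqv.refl z)
      rwa [top_inf_eq] at this
    have h2 := key x
    rw [hxy] at h2
    exact θ.iseqv.trans (θ.iseqv.symm h2) (key y)

lemma nabla_inf (a b : L) : nabla (a ⊓ b) = nabla a ⊓ nabla b := by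
  apply le_antisymm
  · rw [nabla_le_iff]
    exact ⟨by simp [nabla], by simp [nabla]⟩
  · rintro x y ⟨(h₁ : a ⊔ x = a ⊔ y), (h₂ : b ⊔ x = b ⊔ y)⟩
    show a ⊓ b ⊔ x = a ⊓ b ⊔ y
    rw [sup_inf_right, sup_inf_right, h₁, h₂]

lemma nabla_top : nabla (⊤ : L) = ⊤ := by
  rw [eq_top_iff]
  intro x y _
  show ⊤ ⊔ x = ⊤ ⊔ y
  simp

lemma rel_bot_mono {θ : FrameCongruence L} {a b : L} (h : θ.rel ⊥ b) (hab : a ≤ b) :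
    θ.rel ⊥ a := by
  have := θ.inf' h (θ.iseqv.refl a)
  rwa [bot_inf_eq, inf_eq_right.2 hab] at this

lemma nabla_sSup (A : Set L) : nabla (sSup A) = sSup (nabla '' A) := by
  apply le_antisymm
  · rw [nabla_le_iff]
    rcases A.eq_empty_or_nonempty with rfl | hne
    · rw [sSup_empty]
      exact Equivalence.refl (FrameCongruence.iseqv _) _
    · refine Equivalence.symm (FrameCongruence.iseqv _) (sSup_rel _ _ hne fun a ha => ?_)
      exact Equivalence.symm (FrameCongruence.iseqv _)
        (nabla_le_iff.1 (le_sSup (Set.mem_image_of_mem nabla ha)))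
  · refine sSup_le ?_
    rintro _ ⟨a, ha, rfl⟩
    rw [nabla_le_iff]
    exact rel_bot_mono (nabla_le_iff.1 le_rfl) (le_sSup ha)

lemma delta_sup (a b : L) : delta (a ⊔ b) = delta a ⊓ delta b := by
  apply le_antisymm
  · rw [delta_le_iff]
    exact ⟨by simp [delta], by simp [delta]⟩
  · rintro x y ⟨(h₁ : a ⊓ x = a ⊓ y), (h₂ : b ⊓ x = b ⊓ y)⟩
    show (a ⊔ b) ⊓ x = (a ⊔ b) ⊓ y
    rw [inf_sup_right, inf_sup_right, h₁, h₂]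

lemma delta_bot : delta (⊥ : L) = ⊤ := by
  rw [eq_top_iff]
  intro x y _
  show ⊥ ⊓ x = ⊥ ⊓ y
  simp

lemma isCompl_nabla_delta (a : L) : IsCompl (nabla a) (delta a) := by
  constructor
  · rw [disjoint_iff_inf_le]
    rintro x y ⟨(h₁ : a ⊔ x = a ⊔ y), (h₂ : a ⊓ x = a ⊓ y)⟩
    have hxy : x = y := eq_of_inf_eq_sup_eq (a := a) (by rw [inf_comm x, inf_comm y, h₂])
      (by rw [sup_comm x, sup_comm y, h₁])
    rw [hxy]
    exact Equivalence.refl (FrameCongruence.iseqv _) _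
  · rw [codisjoint_iff_le_sup]
    have h : (nabla a ⊔ delta a).rel ⊥ ⊤ :=
      Equivalence.trans (FrameCongruence.iseqv _)
        (nabla_le_iff.1 (le_sup_left : nabla a ≤ nabla a ⊔ delta a))
        (delta_le_iff.1 (le_sup_right : delta a ≤ nabla a ⊔ delta a))
    exact le_of_eq_of_le nabla_top.symm (nabla_le_iff.2 h)

/-- The inverse image of a closed congruence under a frame homomorphism. -/
def pull {M : Type u} [Order.Frame M] (h : FrameHom L M) (m : M) : FrameCongruence L where
  rel x y := (nabla m).rel (h x) (h y)
  iseqv := ⟨fun _ => rfl, Eq.symm, Eq.trans⟩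
  inf' h₁ h₂ := by
    rw [map_inf, map_inf]
    exact (nabla m).inf' h₁ h₂
  sSup' A hA := by
    have h2 := (nabla m).sSup' ((fun p => (h p.1, h p.2)) '' A) (by
      rintro _ ⟨p, hp, rfl⟩
      exact hA p hp)
    rw [Set.image_image, Set.image_image] at h2
    rw [map_sSup, map_sSup, Set.image_image, Set.image_image]
    exact h2

lemma basic_le_pull_iff {M : Type u} [Order.Frame M] (h : FrameHom L M) {a s : L} {c m : M}
    (hc : IsCompl (h s) c) : nabla a ⊓ delta s ≤ pull h m ↔ h a ⊓ c ≤ m := by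
  constructor
  · intro H
    have h1 : m ⊔ h s = m ⊔ h (a ⊔ s) := H s (a ⊔ s)
      ⟨show a ⊔ s = a ⊔ (a ⊔ s) by simp, show s ⊓ s = s ⊓ (a ⊔ s) by simp⟩
    have h2 : h a ≤ m ⊔ h s := by
      rw [h1, map_sup]
      exact le_sup_left.trans le_sup_right
    calc h a ⊓ c ≤ (m ⊔ h s) ⊓ c := inf_le_inf_right c h2
      _ = m ⊓ c := by rw [inf_sup_right, hc.inf_eq_bot, sup_bot_eq]
      _ ≤ m := inf_le_left
  · intro H
    have key : ∀ x y, (nabla a ⊓ delta s).rel x y → h x ≤ m ⊔ h y := by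
      rintro x y ⟨(h₁ : a ⊔ x = a ⊔ y), (h₂ : s ⊓ x = s ⊓ y)⟩
      have h3 : h x = (h x ⊓ h s) ⊔ (h x ⊓ c) := by
        rw [← inf_sup_left, hc.sup_eq_top, inf_top_eq]
      rw [h3]
      refine sup_le ?_ ?_
      · rw [← map_inf, inf_comm, h₂, map_inf]
        exact inf_le_right.trans le_sup_right
      · have h4 : h x ≤ h a ⊔ h y := by
          rw [← map_sup, ← h₁, map_sup]
          exact le_sup_right
        calc h x ⊓ c ≤ (h a ⊔ h y) ⊓ c := inf_le_inf_right c h4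
          _ = (h a ⊓ c) ⊔ (h y ⊓ c) := inf_sup_right _ _ _
          _ ≤ m ⊔ h y := sup_le_sup H inf_le_left
    intro x y hxy
    exact le_antisymm (sup_le le_sup_left (key x y hxy))
      (sup_le le_sup_left (key y x (Equivalence.symm (FrameCongruence.iseqv _) hxy)))

end FrameCongruence

open FrameCongruence

/-! ### Frith frames -/

/-- A Frith frame: a frame with a join-dense bounded sublattice. -/
structure FrithFrm : Type (u + 1) where
  carrier : Type u
  [frame : Order.Frame carrier]
  S : Sublattice carrier
  bot_mem : ⊥ ∈ S
  top_mem : ⊤ ∈ S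
  join_dense : ∀ a : carrier, ∃ A : Set carrier, A ⊆ S ∧ a = sSup A

attribute [instance] FrithFrm.frame

namespace FrithFrm

/-- Morphisms of Frith frames. -/
@[ext]
structure Hom (F G : FrithFrm.{u}) where
  toFrameHom : FrameHom F.carrier G.carrier
  map_mem : ∀ s ∈ F.S, toFrameHom s ∈ G.S

instance : Category FrithFrm.{u} where
  Hom := Hom
  id F := ⟨FrameHom.id F.carrier, fun _ h => h⟩
  comp f g := ⟨g.toFrameHom.comp f.toFrameHom, fun s hs => g.map_mem _ (f.map_mem s hs)⟩

lemma hom_ext {F G : FrithFrm.{u}} {f g : F ⟶ G}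
    (h : ∀ a, f.toFrameHom a = g.toFrameHom a) : f = g :=
  Hom.ext (FrameHom.ext h)

end FrithFrm

/-! ### Biframes -/

/-- A biframe: a frame with two subframes such that every element is a join of finite meets of
positive and negative elements. -/
structure BiFrm : Type (u + 1) where
  carrier : Type u
  [frame : Order.Frame carrier]
  pos : Subframe carrier
  neg : Subframe carrier
  generate : ∀ x : carrier, ∃ A : Set (Finset carrier),
    (∀ F ∈ A, ∀ y ∈ F, y ∈ pos ∨ y ∈ neg) ∧ x = ⨆ F ∈ A, F.inf id

attribute [instance] BiFrm.frame

namespace BiFrm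

/-- Morphisms of biframes. -/
@[ext]
structure Hom (K K' : BiFrm.{u}) where
  toFrameHom : FrameHom K.carrier K'.carrier
  map_pos : ∀ a ∈ K.pos, toFrameHom a ∈ K'.pos
  map_neg : ∀ a ∈ K.neg, toFrameHom a ∈ K'.neg

instance : Category BiFrm.{u} where
  Hom := Hom
  id K := ⟨FrameHom.id K.carrier, fun _ h => h, fun _ h => h⟩
  comp f g := ⟨g.toFrameHom.comp f.toFrameHom, fun a ha => g.map_pos _ (f.map_pos a ha),
    fun a ha => g.map_neg _ (f.map_neg a ha)⟩

lemma hom_ext {K K' : BiFrm.{u}} {f g : K ⟶ K'}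
    (h : ∀ a, f.toFrameHom a = g.toFrameHom a) : f = g :=
  Hom.ext (FrameHom.ext h)

/-- The positive bicomplemented elements. -/
def bicompPos (K : BiFrm.{u}) : Set K.carrier := {a | a ∈ K.pos ∧ ∃ b ∈ K.neg, IsCompl a b}

/-- The negative bicomplemented elements. -/
def bicompNeg (K : BiFrm.{u}) : Set K.carrier := {a | a ∈ K.neg ∧ ∃ b ∈ K.pos, IsCompl a b}

/-- A biframe is compact if its main component is a compact frame. -/
def IsCompact (K : BiFrm.{u}) : Prop := IsCompactElement (⊤ : K.carrier)

/-- A biframe is zero-dimensional if both components are join-generated by their bicomplemented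
elements. -/
def IsZeroDimensional (K : BiFrm.{u}) : Prop :=
  (∀ a ∈ K.pos, ∃ A ⊆ K.bicompPos, a = sSup A) ∧ (∀ a ∈ K.neg, ∃ A ⊆ K.bicompNeg, a = sSup A)

lemma bicompPos_top (K : BiFrm.{u}) : ⊤ ∈ K.bicompPos :=
  ⟨K.pos.top_mem, ⊥, K.neg.bot_mem, isCompl_top_bot⟩

lemma bicompPos_bot (K : BiFrm.{u}) : ⊥ ∈ K.bicompPos :=
  ⟨K.pos.bot_mem, ⊤, K.neg.top_mem, isCompl_bot_top⟩

lemma bicompPos_inf (K : BiFrm.{u}) {a b : K.carrier} (ha : a ∈ K.bicompPos)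
    (hb : b ∈ K.bicompPos) : a ⊓ b ∈ K.bicompPos := by
  obtain ⟨ha, c, hc, hac⟩ := ha
  obtain ⟨hb, d, hd, hbd⟩ := hb
  exact ⟨K.pos.inf_mem ha hb, c ⊔ d, K.neg.sup_mem hc hd, hac.inf_sup hbd⟩

lemma bicompPos_sup (K : BiFrm.{u}) {a b : K.carrier} (ha : a ∈ K.bicompPos)
    (hb : b ∈ K.bicompPos) : a ⊔ b ∈ K.bicompPos := by
  obtain ⟨ha, c, hc, hac⟩ := ha
  obtain ⟨hb, d, hd, hbd⟩ := hb
  exact ⟨K.pos.sup_mem ha hb, c ⊓ d, K.neg.inf_mem hc hd, hac.sup_inf hbd⟩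

lemma map_bicompPos {K K' : BiFrm.{u}} (f : K ⟶ K') {a : K.carrier} (ha : a ∈ K.bicompPos) :
    f.toFrameHom a ∈ K'.bicompPos := by
  obtain ⟨ha, c, hc, hac⟩ := ha
  refine ⟨f.map_pos a ha, _, f.map_neg c hc, ?_⟩
  exact IsCompl.of_eq (by rw [← map_inf, hac.inf_eq_bot, map_bot])
    (by rw [← map_sup, hac.sup_eq_top, map_top])

/-- The subframe generated by the positive bicomplemented elements. -/
def genPos (K : BiFrm.{u}) : Subframe K.carrier := Subframe.closure K.bicompPos

lemma map_genPos {K K' : BiFrm.{u}} (f : K ⟶ K') (a : K.carrier) (ha : a ∈ K.genPos) :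
    f.toFrameHom a ∈ K'.genPos :=
  Subframe.closure_le (K := Subframe.comap f.toFrameHom K'.genPos)
    (fun _ hx => Subframe.subset_closure _ (map_bicompPos f hx)) ha

end BiFrm

/-! ### The functor of bicomplemented elements -/

/-- The Frith frame of positive bicomplemented elements of a biframe, together with the frame they
generate. -/
def bPlusObj (K : BiFrm.{u}) : FrithFrm.{u} where
  carrier := K.genPos
  S :=
    { carrier := {x | x.1 ∈ K.bicompPos}
      supClosed' := fun _ ha _ hb => K.bicompPos_sup ha hb
      infClosed' := fun _ ha _ hb => K.bicompPos_inf ha hb }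
  bot_mem := K.bicompPos_bot
  top_mem := K.bicompPos_top
  join_dense := by
    let J : Subframe K.genPos := Subframe.joins {x | x.1 ∈ K.bicompPos} K.bicompPos_top
      (fun _ ha _ hb => K.bicompPos_inf ha hb)
    have hJ : ∀ x, x ∈ J := Subframe.mem_of_generators J fun x hx =>
      ⟨{⟨x, Subframe.subset_closure _ hx⟩}, by simpa using hx, sSup_singleton.symm⟩
    exact fun a => hJ a

/-- The functor from biframes to Frith frames given by positive bicomplemented elements; on
morphisms it restricts and corestricts. -/
def bPlus : BiFrm.{u} ⥤ FrithFrm.{u} where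
  obj := bPlusObj
  map {K K'} f := ⟨Subframe.restrict f.toFrameHom K.genPos K'.genPos (BiFrm.map_genPos f),
    fun _ hs => BiFrm.map_bicompPos f hs⟩

/-! ### The frame `C_S L` -/

namespace FrithFrm

variable (F : FrithFrm.{u})

/-- The closed congruences together with the open congruences of elements of `S`. -/
def congGen : Set (FrameCongruence F.carrier) := Set.range nabla ∪ delta '' (F.S : Set F.carrier)

/-- The subframe `C_S L` of the frame of congruences generated by all closed congruences and the
open congruences of elements of `S`. -/
def congS : Subframe (FrameCongruence F.carrier) := Subframe.closure F.congGen

/-- The closed congruence of `a` as an element of `C_S L`; this is a frame homomorphism. -/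
def nablaHom : FrameHom F.carrier F.congS where
  toFun a := ⟨nabla a, Subframe.subset_closure _ (Or.inl ⟨a, rfl⟩)⟩
  map_inf' a b := Subtype.ext (nabla_inf a b)
  map_top' := Subtype.ext nabla_top
  map_sSup' A := Subtype.ext (by
    show nabla (sSup A) = sSup (Subtype.val '' _)
    rw [nabla_sSup, Set.image_image])

/-- The open congruence of `s ∈ S` as an element of `C_S L`. -/
def deltaS (s : F.S) : F.congS :=
  ⟨delta s.1, Subframe.subset_closure _ (Or.inr ⟨s.1, s.2, rfl⟩)⟩

lemma isCompl_nablaHom_deltaS (s : F.S) : IsCompl (F.nablaHom s.1) (F.deltaS s) :=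
  IsCompl.of_eq (Subtype.ext (isCompl_nabla_delta s.1).inf_eq_bot)
    (Subtype.ext (isCompl_nabla_delta s.1).sup_eq_top)

/-- A subframe of `C_S L` with all `∇ a` and all `Δ s` is everything. -/
lemma mem_of_nabla_delta (J : Subframe F.congS) (h₁ : ∀ a, F.nablaHom a ∈ J)
    (h₂ : ∀ s, F.deltaS s ∈ J) (x : F.congS) : x ∈ J := by
  refine Subframe.mem_of_generators J ?_ x
  rintro _ (⟨a, rfl⟩ | ⟨s, hs, rfl⟩)
  · exact h₁ a
  · exact h₂ ⟨s, hs⟩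

/-- The elements `∇ s` of `C_S L` and their complements `Δ s`, for `s ∈ S`. -/
def symGen : Set F.congS := {x | ∃ s : F.S, x = F.nablaHom s.1 ∨ x = F.deltaS s}

/-- The sublattice `S̄` of `C_S L` generated by the elements `∇ s` and `Δ s`, for `s ∈ S`. -/
def symS : Sublattice F.congS :=
  Sublattice.ofIsSublattice _ (isSublattice_latticeClosure (s := F.symGen))

/-- The symmetric reflection `(C_S L, S̄)` of a Frith frame. -/
def sym : FrithFrm.{u} where
  carrier := F.congS
  S := F.symS
  bot_mem := subset_latticeClosure ⟨⟨⊥, F.bot_mem⟩, Or.inl (map_bot F.nablaHom).symm⟩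
  top_mem := subset_latticeClosure ⟨⟨⊤, F.top_mem⟩, Or.inl (map_top F.nablaHom).symm⟩
  join_dense := by
    let T : Sublattice F.congS := F.symS
    have hT : F.symGen ⊆ T := subset_latticeClosure
    let J : Subframe F.congS := Subframe.joins (T : Set F.congS)
      (hT ⟨⟨⊤, F.top_mem⟩, Or.inl (map_top F.nablaHom).symm⟩)
      (fun _ ha _ hb => T.inf_mem ha hb)
    refine fun x => F.mem_of_nabla_delta J (fun a => ?_) (fun s => ?_) x
    · obtain ⟨A, hA, rfl⟩ := F.join_dense a
      refine ⟨F.nablaHom '' A, ?_, map_sSup F.nablaHom A⟩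
      rintro _ ⟨s, hs, rfl⟩
      exact hT ⟨⟨s, hA hs⟩, Or.inl rfl⟩
    · exact ⟨{F.deltaS s}, by simpa using hT ⟨s, Or.inr rfl⟩, by simp⟩

/-- A Frith frame is symmetric if its lattice is a Boolean algebra. -/
def IsSymmetric : Prop := ∀ b ∈ F.S, ∃ c ∈ F.S, IsCompl b c

/-- A symmetric Frith frame is complete if every dense extremal epimorphism onto it from a symmetric
Frith frame is an isomorphism. Here a morphism `f : (M, C) → (L, B)` is dense if `f a = 0` implies
`a = 0`, and it is called an extremal epimorphism if `f[C] = B`. -/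
def IsCompleteSymmetric : Prop :=
  ∀ (G : FrithFrm.{u}) (f : G ⟶ F), G.IsSymmetric →
    (∀ a, f.toFrameHom a = ⊥ → a = ⊥) →
    f.toFrameHom '' (G.S : Set G.carrier) = (F.S : Set F.carrier) → IsIso f

/-- A Frith frame is complete if its symmetric reflection is. -/
def IsComplete : Prop := F.sym.IsCompleteSymmetric

/-! ### The universal property of `C_S L` -/

variable {F}

/-- Every element of `C_S L` is the join of the elements `∇ a ⊓ Δ s` below it. -/
lemma exists_basic (x : F.congS) {φ : FrameCongruence F.carrier}
    (h : ∀ a, ∀ s ∈ F.S, nabla a ⊓ delta s ≤ x.1 → nabla a ⊓ delta s ≤ φ) : x.1 ≤ φ := by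
  let J : Subframe (FrameCongruence F.carrier) := Subframe.joins
    {θ | ∃ a, ∃ s ∈ F.S, θ = nabla a ⊓ delta s}
    ⟨⊤, ⊥, F.bot_mem, by rw [nabla_top, delta_bot, inf_top_eq]⟩ (by
      rintro _ ⟨a, s, hs, rfl⟩ _ ⟨b, t, ht, rfl⟩
      exact ⟨a ⊓ b, s ⊔ t, F.S.sup_mem hs ht, by
        rw [nabla_inf, delta_sup, inf_inf_inf_comm]⟩)
  have hx : x.1 ∈ J := by
    refine Subframe.closure_le (K := J) ?_ x.2
    rintro _ (⟨a, rfl⟩ | ⟨s, hs, rfl⟩)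
    · refine ⟨{nabla a}, ?_, by simp⟩
      rintro _ rfl
      exact ⟨a, ⊥, F.bot_mem, by rw [delta_bot, inf_top_eq]⟩
    · refine ⟨{delta s}, ?_, by simp⟩
      rintro _ rfl
      exact ⟨⊤, s, hs, by rw [nabla_top, top_inf_eq]⟩
  obtain ⟨A, hA, hxA⟩ := hx
  rw [hxA]
  refine sSup_le fun θ hθ => ?_
  obtain ⟨a, s, hs, rfl⟩ := hA hθ
  exact h a s hs (hxA ▸ le_sSup hθ)

variable {M : Type u} [Order.Frame M] (h : FrameHom F.carrier M)

/-- The value at a congruence of the extension of `h` to `C_S L`. -/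
def liftFun (x : F.congS) : M :=
  sSup {m | ∃ a, ∃ s ∈ F.S, ∃ c, IsCompl (h s) c ∧ nabla a ⊓ delta s ≤ x.1 ∧ m = h a ⊓ c}

lemma liftFun_le_iff (hc : ∀ s ∈ F.S, IsComplemented (h s)) (x : F.congS) (m : M) :
    liftFun h x ≤ m ↔ x.1 ≤ pull h m := by
  constructor
  · intro H
    refine exists_basic x fun a s hs hle => ?_
    obtain ⟨c, hc⟩ := hc s hs
    have hm : h a ⊓ c ≤ liftFun h x := le_sSup ⟨a, s, hs, c, hc, hle, rfl⟩
    exact (basic_le_pull_iff h hc).2 (hm.trans H)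
  · intro H
    refine sSup_le ?_
    rintro _ ⟨a, s, hs, c, hc, hle, rfl⟩
    exact (basic_le_pull_iff h hc).1 (hle.trans H)

lemma liftFun_nabla (hc : ∀ s ∈ F.S, IsComplemented (h s)) (a : F.carrier) :
    liftFun h (F.nablaHom a) = h a := by
  refine eq_of_forall_ge_iff fun m => ?_
  rw [liftFun_le_iff h hc]
  show nabla a ≤ pull h m ↔ _
  rw [nabla_le_iff]
  show m ⊔ h ⊥ = m ⊔ h a ↔ _
  rw [map_bot, sup_bot_eq, eq_comm, sup_eq_left]

/-- The unique extension along `∇` of a frame homomorphism that sends the elements of `S` to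
complemented elements. -/
def lift (hc : ∀ s ∈ F.S, IsComplemented (h s)) : FrameHom F.congS M where
  toFun := liftFun h
  map_top' := by
    rw [← map_top F.nablaHom, liftFun_nabla h hc, map_top]
  map_inf' x y := by
    have mono : ∀ x y : F.congS, x ≤ y → liftFun h x ≤ liftFun h y := fun x y hxy => by
      rw [liftFun_le_iff h hc]
      exact le_trans (show x.1 ≤ y.1 from hxy) ((liftFun_le_iff h hc y _).1 le_rfl)
    apply le_antisymm
    · exact le_inf (mono _ _ inf_le_left) (mono _ _ inf_le_right)
    · unfold liftFun
      rw [sSup_inf_sSup]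
      refine iSup₂_le ?_
      rintro ⟨p, q⟩ ⟨⟨a, s, hs, c, hc, hx, hp⟩, ⟨b, t, ht, d, hd, hy, hq⟩⟩
      refine le_sSup ⟨a ⊓ b, s ⊔ t, F.S.sup_mem hs ht, c ⊓ d, ?_, ?_, ?_⟩
      · rw [map_sup]
        exact hc.sup_inf hd
      · rw [nabla_inf, delta_sup, inf_inf_inf_comm]
        exact inf_le_inf hx hy
      · show p ⊓ q = _
        rw [show p = h a ⊓ c from hp, show q = h b ⊓ d from hq, map_inf, inf_inf_inf_comm]
  map_sSup' A := by
    refine eq_of_forall_ge_iff fun m => ?_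
    rw [liftFun_le_iff h hc, Subframe.coe_sSup, sSup_le_iff, sSup_le_iff]
    constructor
    · rintro H _ ⟨x, hx, rfl⟩
      exact (liftFun_le_iff h hc x m).2 (H _ ⟨x, hx, rfl⟩)
    · rintro H _ ⟨x, hx, rfl⟩
      exact (liftFun_le_iff h hc x m).1 (H _ ⟨x, hx, rfl⟩)

lemma lift_nabla (hc : ∀ s ∈ F.S, IsComplemented (h s)) (a : F.carrier) :
    lift h hc (F.nablaHom a) = h a := liftFun_nabla h hc a

lemma congS_hom_ext {f g : FrameHom F.congS M}
    (hfg : ∀ a, f (F.nablaHom a) = g (F.nablaHom a)) (x : F.congS) : f x = g x := by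
  refine F.mem_of_nabla_delta (Subframe.eqLocus f g) hfg (fun s => ?_) x
  have key : ∀ k : FrameHom F.congS M, IsCompl (k (F.nablaHom s.1)) (k (F.deltaS s)) := fun k =>
    IsCompl.of_eq
      (by rw [← map_inf, (F.isCompl_nablaHom_deltaS s).inf_eq_bot, map_bot])
      (by rw [← map_sup, (F.isCompl_nablaHom_deltaS s).sup_eq_top, map_top])
  have h1 := key f
  rw [hfg] at h1
  exact h1.right_unique (key g)

lemma lift_delta (hc : ∀ s ∈ F.S, IsComplemented (h s)) (s : F.S) {c : M}
    (hs : IsCompl (h s.1) c) : lift h hc (F.deltaS s) = c := by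
  have h1 : IsCompl (lift h hc (F.nablaHom s.1)) (lift h hc (F.deltaS s)) := IsCompl.of_eq
    (by rw [← map_inf, (F.isCompl_nablaHom_deltaS s).inf_eq_bot, map_bot])
    (by rw [← map_sup, (F.isCompl_nablaHom_deltaS s).sup_eq_top, map_top])
  rw [lift_nabla] at h1
  exact h1.right_unique hs

end FrithFrm

/-! ### The Skula functor -/

open FrithFrm

lemma generate_of_nabla_delta (F : FrithFrm.{u}) (P N : Subframe F.congS)
    (hP : ∀ a, F.nablaHom a ∈ P) (hN : ∀ s, F.deltaS s ∈ N) (x : F.congS) :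
    ∃ A : Set (Finset F.congS), (∀ T ∈ A, ∀ y ∈ T, y ∈ P ∨ y ∈ N) ∧ x = ⨆ T ∈ A, T.inf id := by
  classical
  let J : Subframe F.congS := Subframe.joins
    {z | ∃ T : Finset F.congS, (∀ y ∈ T, y ∈ P ∨ y ∈ N) ∧ z = T.inf id}
    ⟨∅, by simp, by simp⟩ (by
      rintro _ ⟨T, hT, rfl⟩ _ ⟨T', hT', rfl⟩
      refine ⟨T ∪ T', fun y hy => ?_, Finset.inf_union.symm⟩
      rcases Finset.mem_union.1 hy with hy | hy
      · exact hT y hy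
      · exact hT' y hy)
  obtain ⟨A, hA, rfl⟩ : x ∈ J := F.mem_of_nabla_delta J
    (fun a => ⟨{F.nablaHom a}, by
      rintro _ rfl
      exact ⟨{F.nablaHom a}, by simpa using Or.inl (hP a), by simp⟩, by simp⟩)
    (fun s => ⟨{F.deltaS s}, by
      rintro _ rfl
      exact ⟨{F.deltaS s}, by simpa using Or.inr (hN s), by simp⟩, by simp⟩) x
  refine ⟨{T | (∀ y ∈ T, y ∈ P ∨ y ∈ N) ∧ T.inf id ∈ A}, fun T hT => hT.1, ?_⟩
  apply le_antisymm
  · refine sSup_le fun z hz => ?_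
    obtain ⟨T, hT, rfl⟩ := hA hz
    exact le_iSup₂_of_le T ⟨hT, hz⟩ le_rfl
  · exact iSup₂_le fun T hT => le_sSup hT.2

/-- The biframe `(C_S L, ∇L, ΔS)`, where `∇L` and `ΔS` are the subframes generated by the closed
congruences and by the open congruences of elements of `S`, respectively. -/
def skulaObj (F : FrithFrm.{u}) : BiFrm.{u} where
  carrier := F.congS
  pos := Subframe.closure (Set.range F.nablaHom)
  neg := Subframe.closure (Set.range F.deltaS)
  generate := generate_of_nabla_delta F _ _ (fun a => Subframe.subset_closure _ ⟨a, rfl⟩)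
    (fun s => Subframe.subset_closure _ ⟨s, rfl⟩)

/-- A frame homomorphism that sends `L` to positive elements and `S` to bicomplemented elements
extends to a biframe homomorphism on the Skula biframe. -/
def liftHom {F : FrithFrm.{u}} {K : BiFrm.{u}} (h : FrameHom F.carrier K.carrier)
    (hpos : ∀ a, h a ∈ K.pos) (hS : ∀ s ∈ F.S, h s ∈ K.bicompPos) : skulaObj F ⟶ K :=
  have hc : ∀ s ∈ F.S, IsComplemented (h s) := fun s hs =>
    (hS s hs).2.elim fun c hc => ⟨c, hc.2⟩
  { toFrameHom := lift h hc
    map_pos := fun _ ha => Subframe.closure_le (K := Subframe.comap (lift h hc) K.pos) (by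
      rintro _ ⟨a, rfl⟩
      show lift h hc (F.nablaHom a) ∈ K.pos
      rw [lift_nabla]
      exact hpos a) ha
    map_neg := fun _ ha => Subframe.closure_le (K := Subframe.comap (lift h hc) K.neg) (by
      rintro _ ⟨s, rfl⟩
      obtain ⟨c, hc', hsc⟩ := (hS s.1 s.2).2
      show lift h hc (F.deltaS s) ∈ K.neg
      rw [lift_delta h hc s hsc]
      exact hc') ha }

lemma liftHom_nabla {F : FrithFrm.{u}} {K : BiFrm.{u}} (h : FrameHom F.carrier K.carrier)
    (hpos : ∀ a, h a ∈ K.pos) (hS : ∀ s ∈ F.S, h s ∈ K.bicompPos) (a : F.carrier) :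
    (liftHom h hpos hS).toFrameHom (F.nablaHom a) = h a :=
  lift_nabla h (fun s hs => (hS s hs).2.elim fun c hc => ⟨c, hc.2⟩) a

lemma skula_hom_ext {F : FrithFrm.{u}} {K : BiFrm.{u}} {f g : skulaObj F ⟶ K}
    (h : ∀ a, f.toFrameHom (F.nablaHom a) = g.toFrameHom (F.nablaHom a)) : f = g :=
  BiFrm.hom_ext (congS_hom_ext h)

lemma nablaHom_mem_pos (F : FrithFrm.{u}) (a : F.carrier) : F.nablaHom a ∈ (skulaObj F).pos :=
  Subframe.subset_closure _ ⟨a, rfl⟩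

lemma nablaHom_mem_bicompPos (F : FrithFrm.{u}) {s : F.carrier} (hs : s ∈ F.S) :
    F.nablaHom s ∈ (skulaObj F).bicompPos :=
  ⟨nablaHom_mem_pos F s, F.deltaS ⟨s, hs⟩, Subframe.subset_closure _ ⟨⟨s, hs⟩, rfl⟩,
    F.isCompl_nablaHom_deltaS ⟨s, hs⟩⟩

lemma nablaHom_mem_genPos (F : FrithFrm.{u}) (a : F.carrier) :
    F.nablaHom a ∈ (skulaObj F).genPos := by
  obtain ⟨A, hA, rfl⟩ := F.join_dense a
  rw [map_sSup F.nablaHom]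
  refine (skulaObj F).genPos.sSup_mem (A := F.nablaHom '' A) ?_
  rintro _ ⟨s, hs, rfl⟩
  exact Subframe.subset_closure _ (nablaHom_mem_bicompPos F (hA hs))

/-- The unique biframe homomorphism extending `f`, that is, mapping `∇ a` to `∇ (f a)`. -/
def skulaMap {F G : FrithFrm.{u}} (f : F ⟶ G) : skulaObj F ⟶ skulaObj G :=
  liftHom (K := skulaObj G) (G.nablaHom.comp f.toFrameHom)
    (fun _ => nablaHom_mem_pos G _) (fun s hs => nablaHom_mem_bicompPos G (f.map_mem s hs))

/-- The Skula functor from Frith frames to biframes. -/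
def skula : FrithFrm.{u} ⥤ BiFrm.{u} where
  obj := skulaObj
  map f := skulaMap f
  map_id F := skula_hom_ext fun a => liftHom_nabla _ _ _ a
  map_comp {F G H} f g := skula_hom_ext fun a => by
    refine (liftHom_nabla _ _ _ a).trans (Eq.symm ?_)
    refine (congrArg (skulaMap g).toFrameHom (liftHom_nabla _ _ _ a)).trans ?_
    exact liftHom_nabla _ _ _ _

/-! ### The adjunction -/

/-- Restriction of a biframe homomorphism `C_S L → K` along `∇`. -/
def transpose {F : FrithFrm.{u}} {K : BiFrm.{u}} (g : skulaObj F ⟶ K) : F ⟶ bPlusObj K :=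
  ⟨Subframe.corestrict (FrameHom.comp (β := (skulaObj F).carrier) g.toFrameHom F.nablaHom)
      K.genPos (fun a => BiFrm.map_genPos g _ (nablaHom_mem_genPos F a)),
    fun _ hs => BiFrm.map_bicompPos g (nablaHom_mem_bicompPos F hs)⟩

lemma genPos_le_pos (K : BiFrm.{u}) {a : K.carrier} (ha : a ∈ K.genPos) : a ∈ K.pos :=
  Subframe.closure_le (K := K.pos) (fun _ hx => hx.1) ha

/-- Extension of a morphism of Frith frames to the Skula biframe. -/
def transposeInv {F : FrithFrm.{u}} {K : BiFrm.{u}} (f : F ⟶ bPlusObj K) : skulaObj F ⟶ K :=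
  liftHom (K.genPos.incl.comp f.toFrameHom) (fun a => genPos_le_pos K (f.toFrameHom a).2)
    (fun s hs => f.map_mem s hs)

lemma transposeInv_nabla {F : FrithFrm.{u}} {K : BiFrm.{u}} (f : F ⟶ bPlusObj K)
    (a : F.carrier) : (transposeInv f).toFrameHom (F.nablaHom a) = (f.toFrameHom a).1 :=
  liftHom_nabla _ _ _ a

lemma skulaMap_nabla {F G : FrithFrm.{u}} (f : F ⟶ G) (a : F.carrier) :
    (skulaMap f).toFrameHom (F.nablaHom a) = G.nablaHom (f.toFrameHom a) :=
  liftHom_nabla _ _ _ a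

/-- The adjunction between the Skula functor and the functor of positive bicomplemented elements:
morphisms `h` of the biframe `(C_S L, ∇L, ΔS)` correspond to their restrictions `a ↦ h (∇ a)`. -/
def skulaAdj : skula.{u} ⊣ bPlus.{u} :=
  Adjunction.mkOfHomEquiv
    { homEquiv := fun F K =>
        { toFun := fun g => transpose g
          invFun := fun f => transposeInv f
          left_inv := fun g => skula_hom_ext fun a => transposeInv_nabla (transpose g) a
          right_inv := fun f => FrithFrm.hom_ext fun a => Subtype.ext (transposeInv_nabla f a) }
      homEquiv_naturality_left_symm := fun f g => skula_hom_ext fun a => by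
        refine (transposeInv_nabla (f ≫ g) a).trans (Eq.symm ?_)
        refine (congrArg (transposeInv g).toFrameHom (skulaMap_nabla f a)).trans ?_
        exact transposeInv_nabla g _
      homEquiv_naturality_right := fun f g => rfl }

/-- The complete Frith frames. -/
def completeFrith : ObjectProperty FrithFrm.{u} := fun F => F.IsComplete

/-- The compact zero-dimensional biframes. -/
def compactZeroDim : ObjectProperty BiFrm.{u} := fun K => K.IsCompact ∧ K.IsZeroDimensional

end FrithBiframe

namespace FrithBiframe

open FrameCongruence FrithFrm

/-! ### Compactness and bijective frame homomorphisms -/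

/-! Everything rests on one characterization, `isComplete_iff`: a Frith frame is complete exactly
when the frame `C_S L` is compact.

If a symmetric Frith frame `(L, B)` is complete, taking joins of ideals of `B` is a dense morphism
from the ideal frame that maps the principal ideals onto `B`. It is therefore an isomorphism, and
ideal frames of bounded lattices are compact. Conversely, a dense homomorphism from a symmetric
Frith frame into a compact frame is injective (`IsSymmetric.injective_of_dense`): complemented
elements of a compact frame are compact, which allows an inequality between images to be tested on
complemented elements, where density decides it. Surjectivity then follows from join-density.

The Skula biframe is always zero-dimensional, so `Sk` sends complete objects to compact
zero-dimensional ones. The unit is always an isomorphism of frames; compactness shows that a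
bicomplemented `∇ a` comes from some `a ∈ S`. The counit at `K` is always dense, so it is injective
when `K` is compact. This embeds `C_S L` in `K`, which gives completeness of `B₊ K`;
zero-dimensionality makes the counit surjective on both parts. -/

/-- The inverse of a bijective frame homomorphism. -/
noncomputable def invFrameHom {L M : Type u} [Order.Frame L] [Order.Frame M] (f : FrameHom L M)
    (hf : Function.Bijective f) : FrameHom M L where
  toFun := (Equiv.ofBijective f hf).symm
  map_inf' a b := hf.1 (by
    rw [map_inf f]
    simp only [Equiv.ofBijective_apply_symm_apply f hf])
  map_top' := hf.1 (by rw [map_top f, Equiv.ofBijective_apply_symm_apply f hf])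
  map_sSup' A := hf.1 (by
    rw [map_sSup f, Set.image_image]
    simp only [Equiv.ofBijective_apply_symm_apply f hf, Set.image_id'])

lemma apply_invFrameHom {L M : Type u} [Order.Frame L] [Order.Frame M] (f : FrameHom L M)
    (hf : Function.Bijective f) (b : M) : f (invFrameHom f hf b) = b :=
  Equiv.ofBijective_apply_symm_apply f hf b

lemma invFrameHom_apply {L M : Type u} [Order.Frame L] [Order.Frame M] (f : FrameHom L M)
    (hf : Function.Bijective f) (a : L) : invFrameHom f hf (f a) = a :=
  Equiv.ofBijective_symm_apply_apply f hf a

/-- A bijective frame homomorphism has a frame inverse, but that inverse respects the lattices only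
if `f` reflects membership in them. The biframe version below needs the same for both parts. -/
lemma FrithFrm.isIso_of_bijective {F G : FrithFrm.{u}} (f : F ⟶ G)
    (hf : Function.Bijective f.toFrameHom) (hS : ∀ a, f.toFrameHom a ∈ G.S → a ∈ F.S) :
    IsIso f :=
  ⟨⟨invFrameHom f.toFrameHom hf, fun b hb => hS _ (by rwa [apply_invFrameHom])⟩,
    FrithFrm.hom_ext fun a => invFrameHom_apply f.toFrameHom hf a,
    FrithFrm.hom_ext fun b => apply_invFrameHom f.toFrameHom hf b⟩

lemma BiFrm.isIso_of_bijective {K K' : BiFrm.{u}} (f : K ⟶ K')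
    (hf : Function.Bijective f.toFrameHom) (hpos : ∀ a, f.toFrameHom a ∈ K'.pos → a ∈ K.pos)
    (hneg : ∀ a, f.toFrameHom a ∈ K'.neg → a ∈ K.neg) : IsIso f :=
  ⟨⟨invFrameHom f.toFrameHom hf, fun b hb => hpos _ (by rwa [apply_invFrameHom]),
      fun b hb => hneg _ (by rwa [apply_invFrameHom])⟩,
    BiFrm.hom_ext fun a => invFrameHom_apply f.toFrameHom hf a,
    BiFrm.hom_ext fun b => apply_invFrameHom f.toFrameHom hf b⟩

lemma le_of_map_le {L M : Type u} [Order.Frame L] [Order.Frame M] {f : FrameHom L M}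
    (hf : Function.Injective f) {a b : L} (h : f a ≤ f b) : a ≤ b :=
  inf_eq_left.1 (hf (by rw [map_inf, inf_eq_left.2 h]))

/-- Injective frame homomorphisms reflect the order, so a directed cover of `⊤` is pushed forward to
`M`, and the member found there already covers `⊤` in `L`. -/
lemma isCompactElement_top_of_injective {L M : Type u} [Order.Frame L] [Order.Frame M]
    {f : FrameHom L M} (hf : Function.Injective f) (hM : IsCompactElement (⊤ : M)) :
    IsCompactElement (⊤ : L) := by
  rw [CompleteLattice.isCompactElement_iff_le_of_directed_sSup_le] at hM ⊢
  intro A hne hdir hA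
  obtain ⟨_, ⟨a, ha, rfl⟩, h⟩ := hM (f '' A) (hne.image f) (by
    rintro _ ⟨a, ha, rfl⟩ _ ⟨b, hb, rfl⟩
    obtain ⟨c, hc, hac, hbc⟩ := hdir a ha b hb
    exact ⟨_, ⟨c, hc, rfl⟩, OrderHomClass.mono f hac, OrderHomClass.mono f hbc⟩) (by
    rw [← map_sSup, top_le_iff.1 hA, map_top])
  exact ⟨a, ha, le_of_map_le hf (by rwa [map_top])⟩

/-- Complemented elements of a compact frame are compact. -/
lemma isCompactElement_of_isCompl {L : Type u} [Order.Frame L] (hL : IsCompactElement (⊤ : L))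
    {c d : L} (h : IsCompl c d) : IsCompactElement c := by
  rw [CompleteLattice.isCompactElement_iff_le_of_directed_sSup_le] at hL ⊢
  intro A hne hdir hA
  -- Joining with the complement `d` turns a directed cover of `c` into one of `⊤`; meeting with `c`
  -- afterwards removes `d` again.
  obtain ⟨_, ⟨a, ha, rfl⟩, hle⟩ := hL ((· ⊔ d) '' A) (hne.image _) (by
    rintro _ ⟨a, ha, rfl⟩ _ ⟨b, hb, rfl⟩
    obtain ⟨c, hc, hac, hbc⟩ := hdir a ha b hb
    exact ⟨_, ⟨c, hc, rfl⟩, sup_le_sup_right hac d, sup_le_sup_right hbc d⟩) (by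
    rw [← h.sup_eq_top]
    obtain ⟨a, ha⟩ := hne
    refine sup_le (hA.trans (sSup_le fun b hb => ?_)) ?_
    · exact le_sup_left.trans (le_sSup ⟨b, hb, rfl⟩)
    · exact (le_sup_right : d ≤ a ⊔ d).trans (le_sSup ⟨a, ha, rfl⟩))
  refine ⟨a, ha, ?_⟩
  calc c ≤ (a ⊔ d) ⊓ c := le_inf (le_top.trans hle) le_rfl
    _ = a ⊓ c := by rw [inf_sup_right, h.symm.inf_eq_bot, sup_bot_eq]
    _ ≤ a := inf_le_left

/-! ### Symmetric Frith frames and dense homomorphisms into compact frames. -/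

namespace FrithFrm

/-- A compact element below the image of `a` is below the image of an element of `S` below `a`. -/
lemma exists_mem_between {F : FrithFrm.{u}} {M : Type u} [Order.Frame M]
    (f : FrameHom F.carrier M) {c : M} (hc : IsCompactElement c) {a : F.carrier}
    (h : c ≤ f a) : ∃ s ∈ F.S, s ≤ a ∧ c ≤ f s := by
  rw [CompleteLattice.isCompactElement_iff_le_of_directed_sSup_le] at hc
  -- Since `S` is closed under finite joins, its elements below `a` form a directed set, with join
  -- `a` by join-density.
  obtain ⟨_, ⟨s, ⟨hs, hsa⟩, rfl⟩, hcs⟩ := hc (f '' {s | s ∈ F.S ∧ s ≤ a})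
    ⟨_, ⊥, ⟨F.bot_mem, bot_le⟩, rfl⟩ (by
      rintro _ ⟨s, ⟨hs, hsa⟩, rfl⟩ _ ⟨t, ⟨ht, hta⟩, rfl⟩
      exact ⟨_, ⟨s ⊔ t, ⟨F.S.sup_mem hs ht, sup_le hsa hta⟩, rfl⟩,
        OrderHomClass.mono f le_sup_left, OrderHomClass.mono f le_sup_right⟩) (by
      rw [← map_sSup]
      refine h.trans (OrderHomClass.mono f ?_)
      obtain ⟨A, hA, rfl⟩ := F.join_dense a
      exact sSup_le_sSup fun s hs => ⟨hA hs, le_sSup hs⟩)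
  exact ⟨s, hs, hsa, hcs⟩

lemma map_isCompl {L M : Type u} [Order.Frame L] [Order.Frame M] (f : FrameHom L M) {a b : L}
    (h : IsCompl a b) : IsCompl (f a) (f b) :=
  IsCompl.of_eq (by rw [← map_inf, h.inf_eq_bot, map_bot])
    (by rw [← map_sup, h.sup_eq_top, map_top])

/-- A dense frame homomorphism from a symmetric Frith frame to a compact frame is injective. -/
lemma IsSymmetric.injective_of_dense {F : FrithFrm.{u}} (hF : F.IsSymmetric) {M : Type u}
    [Order.Frame M] (hM : IsCompactElement (⊤ : M)) (f : FrameHom F.carrier M)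
    (hf : ∀ a, f a = ⊥ → a = ⊥) : Function.Injective f := by
  have key : ∀ a b, f a ≤ f b → a ≤ b := by
    intro a b hab
    obtain ⟨A, hA, rfl⟩ := F.join_dense a
    refine sSup_le fun s hs => ?_
    obtain ⟨c, -, hc⟩ := hF s (hA hs)
    have hle : f s ≤ f b := (OrderHomClass.mono f (le_sSup hs)).trans hab
    -- `f s` is complemented, hence compact, so `b` can be replaced by a complemented `t ≤ b`.
    obtain ⟨t, ht, htb, hst⟩ :=
      exists_mem_between f (isCompactElement_of_isCompl hM (map_isCompl f hc)) hle
    obtain ⟨d, -, hd⟩ := hF t ht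
    refine le_trans ?_ htb
    -- With `d` the complement of `t`, `s ≤ t` means `s ⊓ d = ⊥`, which density allows to be checked
    -- after applying `f`.
    refine hd.disjoint_right_iff.1 (disjoint_iff.2 (hf _ ?_))
    rw [map_inf]
    exact le_bot_iff.1 ((inf_le_inf_right _ hst).trans (map_isCompl f hd).inf_eq_bot.le)
  exact fun a b h => le_antisymm (key a b h.le) (key b a h.ge)

lemma surjective_of_image_eq {F G : FrithFrm.{u}} (f : FrameHom F.carrier G.carrier)
    (hf : (G.S : Set G.carrier) ⊆ f '' (F.S : Set F.carrier)) : Function.Surjective f := by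
  intro b
  obtain ⟨A, hA, rfl⟩ := G.join_dense b
  refine ⟨sSup (f ⁻¹' A), ?_⟩
  rw [map_sSup, Set.image_preimage_eq_of_subset]
  intro x hx
  obtain ⟨a, -, rfl⟩ := hf (hA hx)
  exact ⟨a, rfl⟩

/-- A compact symmetric Frith frame is complete. -/
lemma isCompleteSymmetric_of_isCompactElement_top {F : FrithFrm.{u}}
    (hF : IsCompactElement (⊤ : F.carrier)) : F.IsCompleteSymmetric := by
  intro G f hG hdense him
  have hinj := hG.injective_of_dense hF f.toFrameHom hdense
  refine isIso_of_bijective f ⟨hinj, surjective_of_image_eq _ him.ge⟩ fun a ha => ?_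
  obtain ⟨c, hc, hca⟩ := him.ge ha
  rwa [← hinj hca]

/-- The symmetric reflection of a Frith frame is symmetric. -/
lemma isSymmetric_sym (F : FrithFrm.{u}) : F.sym.IsSymmetric := by
  -- By De Morgan, the elements with a complement in `S̄` form a sublattice; it contains the
  -- generators because `∇ s` and `Δ s` complement each other.
  let T : Sublattice F.congS :=
    { carrier := {x | ∃ y ∈ F.symS, IsCompl x y}
      supClosed' := by
        rintro a ⟨c, hc, hac⟩ b ⟨d, hd, hbd⟩
        exact ⟨c ⊓ d, F.symS.inf_mem hc hd, hac.sup_inf hbd⟩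
      infClosed' := by
        rintro a ⟨c, hc, hac⟩ b ⟨d, hd, hbd⟩
        exact ⟨c ⊔ d, F.symS.sup_mem hc hd, hac.inf_sup hbd⟩ }
  intro b hb
  have h : latticeClosure F.symGen ⊆ (T : Set F.congS) :=
    latticeClosure_min (by
      rintro _ ⟨s, rfl | rfl⟩
      · exact ⟨_, subset_latticeClosure ⟨s, Or.inr rfl⟩, F.isCompl_nablaHom_deltaS s⟩
      · exact ⟨_, subset_latticeClosure ⟨s, Or.inl rfl⟩, (F.isCompl_nablaHom_deltaS s).symm⟩)
      ⟨T.supClosed, T.infClosed⟩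
  exact h hb

/-! ### The frame of ideals -/

/-- The ideals of a bounded distributive lattice form a frame. -/
instance idealFrame {B : Type u} [DistribLattice B] [OrderBot B] : Order.Frame (Order.Ideal B) :=
  Order.Frame.ofMinimalAxioms
    { inf_sSup_le_iSup_inf := fun I A => by
        -- `J` plays the role of the Heyting implication from `I` to the join of the `I ⊓ K`. It is
        -- an ideal by distributivity, and it contains every `K ∈ A`.
        let J : Order.Ideal B :=
          { carrier := {x | ∀ i ∈ I, i ⊓ x ∈ (⨆ K ∈ A, I ⊓ K : Order.Ideal B)}
            lower' := fun x y hyx hx i hi => Order.Ideal.lower _ (inf_le_inf_left i hyx) (hx i hi)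
            nonempty' := ⟨⊥, fun i _ => by
              rw [inf_bot_eq]
              exact Order.Ideal.bot_mem _⟩
            directed' := fun x hx y hy => ⟨x ⊔ y, fun i hi => by
              rw [inf_sup_left]
              exact Order.Ideal.sup_mem (hx i hi) (hy i hi), le_sup_left, le_sup_right⟩ }
        have hJ : sSup A ≤ J := sSup_le fun K hK x hx i hi => by
          have h : I ⊓ K ≤ (⨆ K ∈ A, I ⊓ K : Order.Ideal B) := le_iSup₂_of_le K hK le_rfl
          exact h ⟨I.lower inf_le_left hi, K.lower inf_le_right hx⟩
        rintro x ⟨hxI, hxA⟩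
        have h := hJ hxA x hxI
        rwa [inf_idem] at h }

/-- The union of a directed family of ideals is an ideal, so if the family joins to the whole
lattice, one member contains `⊤` and is already everything. -/
lemma isCompactElement_top_ideal {B : Type u} [DistribLattice B] [BoundedOrder B] :
    IsCompactElement (⊤ : Order.Ideal B) := by
  rw [CompleteLattice.isCompactElement_iff_le_of_directed_sSup_le]
  intro A hne hdir hA
  let J : Order.Ideal B :=
    { carrier := {x | ∃ K ∈ A, x ∈ K}
      lower' := fun x y hyx ⟨K, hK, hx⟩ => ⟨K, hK, K.lower hyx hx⟩
      nonempty' := hne.elim fun K hK => ⟨⊥, K, hK, K.bot_mem⟩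
      directed' := fun x ⟨K, hK, hx⟩ y ⟨K', hK', hy⟩ => by
        obtain ⟨K'', hK'', h, h'⟩ := hdir K hK K' hK'
        exact ⟨x ⊔ y, ⟨K'', hK'', Order.Ideal.sup_mem (h hx) (h' hy)⟩,
          le_sup_left, le_sup_right⟩ }
  have hJ : sSup A ≤ J := sSup_le fun K hK x hx => ⟨K, hK, hx⟩
  obtain ⟨K, hK, h⟩ := hJ (hA (show (⊤ : B) ∈ (⊤ : Order.Ideal B) from trivial))
  exact ⟨K, hK, fun x _ => K.lower le_top h⟩

instance boundedOrderS (F : FrithFrm.{u}) : BoundedOrder F.S where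
  top := ⟨⊤, F.top_mem⟩
  le_top a := show a.1 ≤ ⊤ from le_top
  bot := ⟨⊥, F.bot_mem⟩
  bot_le a := show ⊥ ≤ a.1 from bot_le

/-- The join of an ideal of `S`. -/
def idealJoin (F : FrithFrm.{u}) (I : Order.Ideal F.S) : F.carrier :=
  sSup (Subtype.val '' (I : Set F.S))

/-- The ideal of all elements of `S` below an element. -/
def idealBelow (F : FrithFrm.{u}) (a : F.carrier) : Order.Ideal F.S where
  carrier := {s | s.1 ≤ a}
  lower' s t hts hs := le_trans (show t.1 ≤ s.1 from hts) hs
  nonempty' := ⟨⊥, show ⊥ ≤ a from bot_le⟩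
  directed' s hs t ht := ⟨s ⊔ t, show s.1 ⊔ t.1 ≤ a from sup_le hs ht, le_sup_left, le_sup_right⟩

/-- Being a left adjoint makes `idealJoin` preserve joins; the adjunction at `⊥` later gives its
density. -/
lemma gc_idealJoin (F : FrithFrm.{u}) : GaloisConnection F.idealJoin F.idealBelow := by
  intro I a
  rw [idealJoin, sSup_le_iff, Set.forall_mem_image]
  exact Iff.rfl

lemma idealJoin_principal (F : FrithFrm.{u}) (s : F.S) :
    F.idealJoin (Order.Ideal.principal s) = s.1 :=
  eq_of_forall_ge_iff fun a => by
    rw [gc_idealJoin F, Order.Ideal.principal_le_iff]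
    exact Iff.rfl

/-- Taking joins of ideals is a frame homomorphism. -/
def idealJoinHom (F : FrithFrm.{u}) : FrameHom (Order.Ideal F.S) F.carrier where
  toFun := F.idealJoin
  map_top' := top_le_iff.1 (le_sSup ⟨⊤, trivial, rfl⟩)
  map_inf' I J := by
    apply le_antisymm
    · exact le_inf ((gc_idealJoin F).monotone_l inf_le_left)
        ((gc_idealJoin F).monotone_l inf_le_right)
    -- Frame distributivity reduces the claim to meets `s ⊓ t` with `s ∈ I` and `t ∈ J`, which lie
    -- in both ideals since these are lower sets.
    · rw [idealJoin, idealJoin, sSup_inf_sSup]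
      refine iSup₂_le ?_
      rintro ⟨_, _⟩ ⟨⟨s, hs, rfl⟩, ⟨t, ht, rfl⟩⟩
      exact le_sSup ⟨s ⊓ t, ⟨I.lower inf_le_left hs, J.lower inf_le_right ht⟩, rfl⟩
  map_sSup' A := by
    rw [(gc_idealJoin F).l_sSup, sSup_image]

/-- The Frith frame of ideals of `S` and principal ideals. -/
def ideals (F : FrithFrm.{u}) : FrithFrm.{u} where
  carrier := Order.Ideal F.S
  S :=
    { carrier := Set.range Order.Ideal.principal
      supClosed' := by
        rintro _ ⟨s, rfl⟩ _ ⟨t, rfl⟩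
        refine ⟨s ⊔ t, eq_of_forall_ge_iff fun I => ?_⟩
        rw [sup_le_iff, Order.Ideal.principal_le_iff, Order.Ideal.principal_le_iff,
          Order.Ideal.principal_le_iff, Order.Ideal.sup_mem_iff]
      infClosed' := by
        rintro _ ⟨s, rfl⟩ _ ⟨t, rfl⟩
        refine ⟨s ⊓ t, SetLike.ext fun x => ?_⟩
        rw [Order.Ideal.mem_inf, Order.Ideal.mem_principal, Order.Ideal.mem_principal,
          Order.Ideal.mem_principal, le_inf_iff] }
  bot_mem := ⟨⊥, bot_unique (Order.Ideal.principal_le_iff.2 (Order.Ideal.bot_mem _))⟩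
  top_mem := ⟨⊤, top_unique fun _ _ => Order.Ideal.mem_principal.2 le_top⟩
  join_dense I := by
    refine ⟨Order.Ideal.principal '' (I : Set F.S), Set.image_subset_range _ _, ?_⟩
    apply le_antisymm
    · intro s hs
      have h : Order.Ideal.principal s ≤ sSup (Order.Ideal.principal '' (I : Set F.S)) :=
        le_sSup ⟨s, hs, rfl⟩
      exact Order.Ideal.principal_le_iff.1 h
    · refine sSup_le ?_
      rintro _ ⟨s, hs, rfl⟩
      exact Order.Ideal.principal_le_iff.2 hs

/-- The principal ideal of the complement of `s` is a complement of the principal ideal of `s`. This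
makes `F.ideals` an admissible test object for completeness. -/
lemma IsSymmetric.ideals {F : FrithFrm.{u}} (hF : F.IsSymmetric) : F.ideals.IsSymmetric := by
  rintro _ ⟨s, rfl⟩
  obtain ⟨c, hc, hsc⟩ := hF s.1 s.2
  refine ⟨Order.Ideal.principal ⟨c, hc⟩, ⟨_, rfl⟩, ?_⟩
  constructor
  · refine disjoint_iff_inf_le.2 ?_
    rintro x ⟨hx, hx'⟩
    have h : x.1 ≤ s.1 ⊓ c :=
      le_inf (Order.Ideal.mem_principal.1 hx) (Order.Ideal.mem_principal.1 hx')
    rw [hsc.inf_eq_bot] at h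
    exact Order.Ideal.lower _ (show x ≤ ⊥ from h) (Order.Ideal.bot_mem _)
  · refine codisjoint_iff_le_sup.2 ?_
    intro x _
    exact ⟨s, Order.Ideal.mem_principal.2 le_rfl, ⟨c, hc⟩, Order.Ideal.mem_principal.2 le_rfl,
      show x.1 ≤ s.1 ⊔ c from hsc.sup_eq_top ▸ le_top⟩

/-- A complete symmetric Frith frame is compact. -/
lemma IsCompleteSymmetric.isCompactElement_top {F : FrithFrm.{u}} (hF : F.IsCompleteSymmetric)
    (hS : F.IsSymmetric) : IsCompactElement (⊤ : F.carrier) := by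
  let f : F.ideals ⟶ F := ⟨F.idealJoinHom, by
    rintro _ ⟨s, rfl⟩
    exact Set.mem_of_eq_of_mem (F.idealJoin_principal s) s.2⟩
  have : IsIso f := by
    refine hF F.ideals f hS.ideals (fun I hI => ?_) ?_
    -- Density: an ideal with join `⊥` contains no element other than `⊥`.
    · have h : I ≤ F.idealBelow ⊥ := (gc_idealJoin F I ⊥).1 (le_bot_iff.2 hI)
      exact le_bot_iff.1 fun x hx =>
        Order.Ideal.lower _ (show x ≤ ⊥ from h hx) (Order.Ideal.bot_mem _)
    · ext a
      constructor
      · rintro ⟨_, ⟨s, rfl⟩, rfl⟩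
        exact Set.mem_of_eq_of_mem (F.idealJoin_principal s) s.2
      · intro ha
        exact ⟨_, ⟨⟨a, ha⟩, rfl⟩, F.idealJoin_principal ⟨a, ha⟩⟩
  -- The inverse embeds the frame of `F` into the compact frame of ideals.
  refine isCompactElement_top_of_injective (f := (inv f).toFrameHom)
    (Function.LeftInverse.injective (g := f.toFrameHom) fun a => ?_)
    (isCompactElement_top_ideal (B := F.S))
  exact congrArg (fun k : F ⟶ F => k.toFrameHom a) (IsIso.inv_hom_id f)

/-- This turns completeness, which quantifies over all dense morphisms into the symmetric
reflection, into a property of a single frame. The rest of the proof uses completeness only in this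
form. -/
lemma isComplete_iff (F : FrithFrm.{u}) : F.IsComplete ↔ IsCompactElement (⊤ : F.congS) :=
  ⟨fun h => IsCompleteSymmetric.isCompactElement_top h F.isSymmetric_sym,
    fun h => isCompleteSymmetric_of_isCompactElement_top (F := F.sym) h⟩

end FrithFrm

/-! ### The Skula biframe -/

/-- As `∇` preserves finite meets and all joins, its range is already a subframe. -/
lemma exists_nabla_of_mem_pos {F : FrithFrm.{u}} {x : F.congS} (hx : x ∈ (skulaObj F).pos) :
    ∃ a, x = F.nablaHom a := by
  let J : Subframe F.congS := Subframe.joins (Set.range F.nablaHom) ⟨⊤, map_top _⟩ (by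
    rintro _ ⟨a, rfl⟩ _ ⟨b, rfl⟩
    exact ⟨a ⊓ b, map_inf _ a b⟩)
  have h : x ∈ J := Subframe.closure_le (K := J) (by
    rintro _ ⟨a, rfl⟩
    exact ⟨{F.nablaHom a}, by simp, by simp⟩) hx
  obtain ⟨A, hA, rfl⟩ := h
  refine ⟨sSup (F.nablaHom ⁻¹' A), ?_⟩
  rw [map_sSup, Set.image_preimage_eq_of_subset hA]

lemma isZeroDimensional_skulaObj (F : FrithFrm.{u}) : (skulaObj F).IsZeroDimensional := by
  constructor
  · intro x hx
    obtain ⟨a, rfl⟩ := exists_nabla_of_mem_pos hx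
    obtain ⟨A, hA, rfl⟩ := F.join_dense a
    refine ⟨F.nablaHom '' A, ?_, F.nablaHom.map_sSup' A⟩
    rintro _ ⟨s, hs, rfl⟩
    exact nablaHom_mem_bicompPos F (hA hs)
  · intro x hx
    have hbot : F.deltaS ⊥ = ⊤ := Subtype.ext delta_bot
    have hsup : ∀ s t, F.deltaS s ⊓ F.deltaS t = F.deltaS (s ⊔ t) := fun s t =>
      Subtype.ext (delta_sup s.1 t.1).symm
    -- The `Δ s` are closed under finite meets because `Δ` turns joins into meets. Hence negative
    -- elements are joins of elements `Δ s`, each with complement `∇ s`.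
    let J : Subframe F.congS := Subframe.joins (Set.range F.deltaS) ⟨⊥, hbot⟩ (by
      rintro _ ⟨s, rfl⟩ _ ⟨t, rfl⟩
      exact ⟨s ⊔ t, (hsup s t).symm⟩)
    have h : x ∈ J := Subframe.closure_le (K := J) (by
      rintro _ ⟨s, rfl⟩
      exact ⟨{F.deltaS s}, by simp, by simp⟩) hx
    obtain ⟨A, hA, rfl⟩ := h
    refine ⟨A, fun y hy => ?_, rfl⟩
    obtain ⟨s, rfl⟩ := hA hy
    exact ⟨Subframe.subset_closure _ ⟨s, rfl⟩, _, nablaHom_mem_pos F s.1,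
      (F.isCompl_nablaHom_deltaS s).symm⟩

lemma compactZeroDim_skulaObj {F : FrithFrm.{u}} (hF : F.IsComplete) :
    compactZeroDim (skulaObj F) :=
  ⟨F.isComplete_iff.1 hF, isZeroDimensional_skulaObj F⟩

/-- The element is recovered from its closed congruence: `∇ b` relates `⊥` to `a` exactly when `a ≤
b`. -/
lemma nablaHom_injective (F : FrithFrm.{u}) : Function.Injective F.nablaHom := by
  intro a b h
  have key : ∀ a b, F.nablaHom a = F.nablaHom b → a ≤ b := fun a b h => by
    have h1 : b ⊔ ⊥ = b ⊔ a := nabla_le_iff.1 (show nabla a ≤ nabla b from (Subtype.ext_iff.1 h).le)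
    rw [sup_bot_eq] at h1
    exact sup_eq_left.1 h1.symm
  exact le_antisymm (key a b h) (key b a h.symm)

/-! ### The unit and the counit -/

/-- Bijectivity is formal. Completeness enters only in the last bullet, where `a ∈ S` must be
deduced from `∇ a` being bicomplemented. -/
lemma isIso_unit {F : FrithFrm.{u}} (hF : F.IsComplete) : IsIso (skulaAdj.unit.app F) := by
  rw [F.isComplete_iff] at hF
  refine FrithFrm.isIso_of_bijective _ ⟨fun a b h => ?_, fun x => ?_⟩ fun a ha => ?_
  · exact nablaHom_injective F (congrArg Subtype.val h)
  · obtain ⟨a, ha⟩ := exists_nabla_of_mem_pos (genPos_le_pos _ x.2)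
    exact ⟨a, Subtype.ext ha.symm⟩
  · obtain ⟨-, c, -, hc⟩ := show F.nablaHom a ∈ (skulaObj F).bicompPos from ha
    -- Being complemented in a compact frame, `∇ a` is compact; interpolating in `∇ a ≤ ∇ a` gives
    -- `s ∈ S` with `s ≤ a` and `∇ a ≤ ∇ s`, so `a = s`.
    obtain ⟨s, hs, hsa, has⟩ :=
      exists_mem_between F.nablaHom (isCompactElement_of_isCompl hF hc) le_rfl
    rwa [← le_antisymm hsa (le_of_map_le (nablaHom_injective F) has)]

section Counit

variable (K : BiFrm.{u})

/-- The frame homomorphism underlying the counit. -/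
abbrev counitHom : FrameHom (bPlusObj K).congS K.carrier :=
  (transposeInv (𝟙 (bPlusObj K))).toFrameHom

lemma counitHom_nabla (a : (bPlusObj K).carrier) :
    counitHom K ((bPlusObj K).nablaHom a) = a.1 :=
  transposeInv_nabla (𝟙 (bPlusObj K)) a

/-- Since complements are unique, this determines the counit on the elements `Δ s`. -/
lemma isCompl_counitHom_delta (s : (bPlusObj K).S) :
    IsCompl s.1.1 (counitHom K ((bPlusObj K).deltaS s)) := by
  have h := map_isCompl (counitHom K) ((bPlusObj K).isCompl_nablaHom_deltaS s)
  rwa [counitHom_nabla] at h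

/-- It suffices to treat the elements `∇ a ⊓ Δ s` below `x`. The counit sends such an element to the
meet of `a` with the complement of `s`; if this is `⊥`, then `a ≤ s`, so `∇ a ⊓ Δ s ≤ ∇ s ⊓ Δ s =
⊥`. -/
lemma counitHom_dense (x : (bPlusObj K).congS) (hx : counitHom K x = ⊥) : x = ⊥ := by
  refine le_bot_iff.1 (exists_basic (φ := ⊥) x fun a s hs hle => ?_)
  have h1 : (bPlusObj K).nablaHom a ⊓ (bPlusObj K).deltaS ⟨s, hs⟩ ≤ x := hle
  have h2 := OrderHomClass.mono (counitHom K) h1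
  rw [map_inf, counitHom_nabla, hx, le_bot_iff, ← disjoint_iff] at h2
  have h3 : a ≤ s := (isCompl_counitHom_delta K ⟨s, hs⟩).disjoint_right_iff.1 h2
  have h4 : nabla a ≤ nabla s := by
    have := OrderHomClass.mono (bPlusObj K).nablaHom h3
    exact this
  exact (inf_le_inf_right _ h4).trans (isCompl_nabla_delta s).inf_eq_bot.le

variable {K}

/-- Zero-dimensionality puts `a` in the subframe generated by bicomplemented elements, so `∇ a`
makes sense and is a preimage. Keeping track of the positive part here also shows, once the counit
is injective, that it reflects positivity. -/
lemma exists_counitHom_of_mem_pos (hK : K.IsZeroDimensional) {a : K.carrier} (ha : a ∈ K.pos) :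
    ∃ x ∈ (skulaObj (bPlusObj K)).pos, counitHom K x = a := by
  obtain ⟨A, hA, rfl⟩ := hK.1 a ha
  exact ⟨_, nablaHom_mem_pos (bPlusObj K) ⟨sSup A, K.genPos.sSup_mem fun b hb =>
    Subframe.subset_closure _ (hA hb)⟩, counitHom_nabla K _⟩

lemma exists_counitHom_of_mem_neg (hK : K.IsZeroDimensional) {a : K.carrier} (ha : a ∈ K.neg) :
    ∃ x ∈ (skulaObj (bPlusObj K)).neg, counitHom K x = a := by
  obtain ⟨A, hA, rfl⟩ := hK.2 a ha
  have hA' : A ⊆ counitHom K '' {y | y ∈ (skulaObj (bPlusObj K)).neg} := by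
    intro c hc
    obtain ⟨hneg, b, hb, hcb⟩ := hA hc
    have hb' : b ∈ K.bicompPos := ⟨hb, c, hneg, hcb.symm⟩
    let s : (bPlusObj K).S := ⟨⟨b, Subframe.subset_closure _ hb'⟩, hb'⟩
    -- The complement `b` of `c` is positive and bicomplemented, so `Δ b` is available; its image
    -- and `c` both complement `b`.
    exact ⟨(bPlusObj K).deltaS s, Subframe.subset_closure _ ⟨s, rfl⟩,
      (isCompl_counitHom_delta K s).right_unique hcb.symm⟩
  refine ⟨(sSup {y | y ∈ (skulaObj (bPlusObj K)).neg ∧ counitHom K y ∈ A} : (bPlusObj K).congS),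
    Subframe.sSup_mem (skulaObj (bPlusObj K)).neg fun y hy => hy.1, ?_⟩
  refine (map_sSup (counitHom K) _).trans (congrArg sSup ?_)
  ext c
  constructor
  · rintro ⟨y, hy, rfl⟩
    exact hy.2
  · intro hc
    obtain ⟨y, hy, rfl⟩ := hA' hc
    exact ⟨y, ⟨hy, hc⟩, rfl⟩

lemma counitHom_surjective (hK : K.IsZeroDimensional) : Function.Surjective (counitHom K) := by
  have hgen : ∀ y, y ∈ K.pos ∨ y ∈ K.neg → ∃ x, counitHom K x = y := by
    rintro y (hy | hy)
    · obtain ⟨x, -, hx⟩ := exists_counitHom_of_mem_pos hK hy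
      exact ⟨x, hx⟩
    · obtain ⟨x, -, hx⟩ := exists_counitHom_of_mem_neg hK hy
      exact ⟨x, hx⟩
  have hinf : ∀ T : Finset K.carrier, (∀ y ∈ T, y ∈ K.pos ∨ y ∈ K.neg) →
      ∃ x, counitHom K x = T.inf id := by
    classical
    intro T
    induction T using Finset.induction_on with
    | empty => exact fun _ => ⟨⊤, map_top _⟩
    | insert y T _ ih =>
      intro h
      obtain ⟨x, hx⟩ := hgen y (h y (Finset.mem_insert_self y T))
      obtain ⟨x', hx'⟩ := ih fun z hz => h z (Finset.mem_insert_of_mem hz)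
      exact ⟨x ⊓ x', by rw [map_inf, hx, hx', Finset.inf_insert, id]⟩
  intro b
  obtain ⟨A, hA, rfl⟩ := K.generate b
  choose! g hg using fun T hT => hinf T (hA T hT)
  refine ⟨⨆ T ∈ A, g T, ?_⟩
  rw [map_iSup₂]
  exact iSup_congr fun T => iSup_congr fun hT => hg T hT

/-- The domain carries the symmetric Frith frame `(C_S L, S̄)`, so density suffices over the compact
frame of `K`. -/
lemma counitHom_injective (hK : K.IsCompact) : Function.Injective (counitHom K) :=
  (bPlusObj K).isSymmetric_sym.injective_of_dense hK (counitHom K) (counitHom_dense K)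

lemma isComplete_bPlusObj (hK : K.IsCompact) : (bPlusObj K).IsComplete :=
  (bPlusObj K).isComplete_iff.2 (isCompactElement_top_of_injective (counitHom_injective hK) hK)

lemma isIso_counit (hK : compactZeroDim K) : IsIso (skulaAdj.counit.app K) := by
  have hinj := counitHom_injective hK.1
  refine BiFrm.isIso_of_bijective (transposeInv (𝟙 (bPlusObj K)))
    ⟨hinj, counitHom_surjective hK.2⟩ (fun x hx => ?_) (fun x hx => ?_)
  · obtain ⟨y, hy, hxy⟩ := exists_counitHom_of_mem_pos hK.2 hx
    rwa [← hinj hxy]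
  · obtain ⟨y, hy, hxy⟩ := exists_counitHom_of_mem_neg hK.2 hx
    rwa [← hinj hxy]

end Counit

end FrithBiframe

/-! ### The restricted equivalence. -/

open CategoryTheory FrithBiframe in
theorem mainTheorem9 :
    ∃ (hF : ∀ F : completeFrith.{u}.FullSubcategory, compactZeroDim (skula.obj F.obj))
      (hK : ∀ K : compactZeroDim.{u}.FullSubcategory, completeFrith (bPlus.obj K.obj)),
      let Sk := compactZeroDim.lift (completeFrith.{u}.ι ⋙ skula) hF
      let B := completeFrith.lift (compactZeroDim.{u}.ι ⋙ bPlus) hK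
      Sk.IsEquivalence ∧ B.IsEquivalence ∧
      ∃ (η : 𝟭 _ ≅ Sk ⋙ B) (ε : B ⋙ Sk ≅ 𝟭 _),
        (∀ F, (η.hom.app F).hom = skulaAdj.unit.app F.obj) ∧
        (∀ K, (ε.hom.app K).hom = skulaAdj.counit.app K.obj) := by
  refine ⟨fun F => compactZeroDim_skulaObj F.property,
    fun K => isComplete_bPlusObj K.property.1, ?_⟩
  intro Sk B
  let η : 𝟭 _ ≅ Sk ⋙ B := NatIso.ofComponents
    (fun F => completeFrith.isoMk (X := F) (Y := (Sk ⋙ B).obj F)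
      (have := isIso_unit F.property
       asIso (skulaAdj.unit.app F.obj)))
    (fun {F G} f => ObjectProperty.hom_ext _ (skulaAdj.unit.naturality f.hom))
  let ε : B ⋙ Sk ≅ 𝟭 _ := NatIso.ofComponents
    (fun K => compactZeroDim.isoMk (X := (B ⋙ Sk).obj K) (Y := K)
      (have := isIso_counit K.property
       asIso (skulaAdj.counit.app K.obj)))
    (fun {K K'} f => ObjectProperty.hom_ext _ (skulaAdj.counit.naturality f.hom))
  -- `e` serves only to show that both functors are equivalences. The isomorphisms returned are `η`
  -- and `ε` themselves, whose components are by construction those of the unit and the counit.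
  let e := CategoryTheory.Equivalence.mk Sk B η ε
  exact ⟨e.isEquivalence_functor, e.isEquivalence_inverse, η, ε, fun _ => rfl, fun _ => rfl⟩
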